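/- **Notation.** For nonnegative functions, $f\approx g$ on a set means that $c^{-1}g\le f\le c\,g$ there for some constant $c>0$. A positive, finite, Lebesgue-measurable function $b$ on $(0,\infty)$ is slowly varying, $b\in SV(0,\infty)$, if for every $\varepsilon>0$ the function $t^{\varepsilon}b(t)$ is equivalent ($\approx$) on $(0,\infty)$ to a non-decreasing function and $t^{-\varepsilon}b(t)$ is equivalent to a non-increasing function. A compatible couple $(X_0,X_1)$ is a pair of (real or complex) Banach spaces continuously embedded in a common Hausdorff topological vector space; $X_0\cap X_1$ is normed by $\max\{\|f\|_{X_0},\|f\|_{X_1}\}$ and $X_0+X_1$ by $\inf\{\|f_0\|_{X_0}+\|f_1\|_{X_1}: f=f_0+f_1\}$. Put $$K(f,t;X_0,X_1)=\inf\{\|f_0\|_{X_0}+t\|f_1\|_{X_1}: f=f_0+f_1,\ f_0\in X_0,\ f_1\in X_1\}\quad(f\in X_0+X_1),$$ $$J(f,t;X_0,X_1)=\max\{\|f\|_{X_0},t\|f\|_{X_1}\}\quad(f\in X_0\cap X_1).$$ For $1\le q\le\infty$ and a positive measurable function $v$ on $(0,\infty)$, the space $(X_0,X_1)_{0,q,v;K}$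 consists of all $f\in X_0+X_1$ with $$\|f\|_{0,q,v;K}=\big\|t^{-1/q}v(t)K(f,t;X_0,X_1)\big\|_{L_q(0,\infty)}<\infty,$$ and $(X_0,X_1)_{0,q,v;J}$ consists of all $f\in X_0+X_1$ with $$\|f\|_{0,q,v;J}=\inf_u\big\|t^{-1/q}v(t)J(u(t),t;X_0,X_1)\big\|_{L_q(0,\infty)}<\infty,$$ where the infimum is over all strongly measurable $u:(0,\infty)\to X_0\cap X_1$ with $f=\int_0^\infty u(s)\,\frac{ds}{s}$ as a Bochner integral in $X_0+X_1$ (and is $\infty$ if there is no such $u$). Equality of two such spaces means that they have the same elements and that their norms are equivalent. **Theorem.** Let $(X_0,X_1)$ be a compatible couple, let $1<q\le\infty$ and $1/q+1/q'=1$. Let $a\in SV(0,\infty)$ satisfy $$\int_0^\infty t^{-1}a^{-q'}(t)\,dt<\infty .$$ Let $\alpha\in SV(0,\infty)$ be such that $$\int_0^x t^{-1}\alpha^{-q'}(t)\,dt<\infty\ \text{ for all } x>0,\qquad \int_0^\infty t^{-1}\alpha^{-q'}(t)\,dt=\infty ,$$ let $A\in SV(0,\infty)$ satisfy $A(x)=a(x)$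 for $x\in(0,1]$ and $A\approx\alpha$ on $(1,\infty)$, and let $$B(x)=A^{-q'/q}(x)\Big(\int_0^x t^{-1}A^{-q'}(t)\,dt\Big)^{-1}\quad\text{for all } x>0,$$ where $q'/q$ is read as $0$ if $q=\infty$. Then $$(X_0,X_1)_{0,q,a;J}=(X_0,X_0\cap X_1)_{0,q,A;J}=(X_0,X_0\cap X_1)_{0,q,B;K}.$$ -/

import Mathlib

open MeasureTheory Set
open scoped ENNReal

noncomputable section

/-- Equivalence `f ≈ g` of two nonnegative functions on a set `s`. -/
def EquivOn (s : Set ℝ) (f g : ℝ → ℝ) : Prop :=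
  ∃ c : ℝ, 0 < c ∧ ∀ t ∈ s, f t ≤ c * g t ∧ g t ≤ c * f t

/-- `b ∈ SV(0,∞)`: a positive, finite, Lebesgue-measurable function on `(0,∞)` such that, for each
`ε > 0`, `t^ε b(t)` is equivalent to a non-decreasing function and `t^(-ε) b(t)` is equivalent to a
non-increasing function on `(0,∞)`. Values outside `(0,∞)` play no role. -/
structure SlowlyVarying (b : ℝ → ℝ) : Prop where
  pos : ∀ t, 0 < t → 0 < b t
  measurable : AEMeasurable b (volume.restrict (Ioi 0))
  monotone : ∀ ε : ℝ, 0 < ε →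
    ∃ g : ℝ → ℝ, MonotoneOn g (Ioi 0) ∧ EquivOn (Ioi 0) (fun t => t ^ ε * b t) g
  antitone : ∀ ε : ℝ, 0 < ε →
    ∃ g : ℝ → ℝ, AntitoneOn g (Ioi 0) ∧ EquivOn (Ioi 0) (fun t => t ^ (-ε) * b t) g

/-- Continuous linear embeddings of two normed spaces in a common topological vector space `E`.
When `X₀`, `X₁` are Banach and `E` is a Hausdorff topological vector space, this is a
compatible couple. -/
structure CompatibleCouple (𝕜 X₀ X₁ E : Type*) [RCLike 𝕜]
    [NormedAddCommGroup X₀] [NormedSpace 𝕜 X₀] [NormedAddCommGroup X₁] [NormedSpace 𝕜 X₁]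
    [AddCommGroup E] [Module 𝕜 E] [TopologicalSpace E] where
  /-- the embedding of `X₀` -/
  ι₀ : X₀ →L[𝕜] E
  /-- the embedding of `X₁` -/
  ι₁ : X₁ →L[𝕜] E
  injective₀ : Function.Injective ι₀
  injective₁ : Function.Injective ι₁

namespace CompatibleCouple

variable {𝕜 X₀ X₁ E : Type*} [RCLike 𝕜]
  [NormedAddCommGroup X₀] [NormedSpace 𝕜 X₀] [NormedAddCommGroup X₁] [NormedSpace 𝕜 X₁]
  [AddCommGroup E] [Module 𝕜 E] [TopologicalSpace E]

/-- The intersection `X₀ ∩ X₁`: an element `f` of it is represented by the pair of its (unique)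
preimages in `X₀` and `X₁`. The norm inherited from the product is
`max (‖f‖_{X₀}) (‖f‖_{X₁})`. -/
abbrev Inter (C : CompatibleCouple 𝕜 X₀ X₁ E) : Submodule 𝕜 (X₀ × X₁) :=
  LinearMap.eqLocus ((C.ι₀ : X₀ →ₗ[𝕜] E) ∘ₗ LinearMap.fst 𝕜 X₀ X₁)
    ((C.ι₁ : X₁ →ₗ[𝕜] E) ∘ₗ LinearMap.snd 𝕜 X₀ X₁)

/-- The couple `(X₀, X₀ ∩ X₁)`, embedded in the same space `E`. -/
def interCouple (C : CompatibleCouple 𝕜 X₀ X₁ E) : CompatibleCouple 𝕜 X₀ C.Inter E where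
  ι₀ := C.ι₀
  ι₁ := C.ι₀ ∘L ContinuousLinearMap.fst 𝕜 X₀ X₁ ∘L C.Inter.subtypeL
  injective₀ := C.injective₀
  injective₁ := by
    rintro ⟨⟨x, y⟩, hx⟩ ⟨⟨x', y'⟩, hx'⟩ h
    have h0 : x = x' := C.injective₀ h
    have hx1 : C.ι₀ x = C.ι₁ y := hx
    have hx2 : C.ι₀ x' = C.ι₁ y' := hx'
    have h1 : y = y' := C.injective₁ (by rw [← hx1, ← hx2, h0])
    subst h0; subst h1; rfl

/-- The map `(x₀, x₁) ↦ x₀ + x₁` into `E`, on the product with norm `‖x₀‖ + ‖x₁‖`. -/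
def addMap (C : CompatibleCouple 𝕜 X₀ X₁ E) : WithLp 1 (X₀ × X₁) →ₗ[𝕜] E :=
  ((C.ι₀ : X₀ →ₗ[𝕜] E).coprod (C.ι₁ : X₁ →ₗ[𝕜] E)) ∘ₗ
    (WithLp.linearEquiv 1 𝕜 (X₀ × X₁)).toLinearMap

/-- The sum `X₀ + X₁`, as the quotient of the `ℓ¹`-product of `X₀` and `X₁` by the kernel of
`(x₀, x₁) ↦ x₀ + x₁`. The quotient norm is `inf {‖x₀‖ + ‖x₁‖ : f = x₀ + x₁}`. -/
def Sum (C : CompatibleCouple 𝕜 X₀ X₁ E) : Type _ :=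
  WithLp 1 (X₀ × X₁) ⧸ LinearMap.ker C.addMap

section Sum

variable [IsTopologicalAddGroup E] [T2Space E]

instance isClosed_ker_addMap (C : CompatibleCouple 𝕜 X₀ X₁ E) :
    IsClosed (LinearMap.ker C.addMap : Set (WithLp 1 (X₀ × X₁))) := by
  have h : Continuous C.addMap := by
    have h2 : Continuous fun p : WithLp 1 (X₀ × X₁) => C.ι₀ p.fst + C.ι₁ p.snd := by
      have := WithLp.prod_continuous_ofLp 1 X₀ X₁
      exact (C.ι₀.continuous.comp (continuous_fst.comp this)).add
        (C.ι₁.continuous.comp (continuous_snd.comp this))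
    exact h2
  exact isClosed_singleton.preimage h

instance (C : CompatibleCouple 𝕜 X₀ X₁ E) : NormedAddCommGroup C.Sum :=
  inferInstanceAs (NormedAddCommGroup (WithLp 1 (X₀ × X₁) ⧸ LinearMap.ker C.addMap))

instance (C : CompatibleCouple 𝕜 X₀ X₁ E) : NormedSpace 𝕜 C.Sum :=
  inferInstanceAs (NormedSpace 𝕜 (WithLp 1 (X₀ × X₁) ⧸ LinearMap.ker C.addMap))

instance (C : CompatibleCouple 𝕜 X₀ X₁ E) : NormedSpace ℝ C.Sum :=
  NormedSpace.restrictScalars ℝ 𝕜 C.Sum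

instance (C : CompatibleCouple 𝕜 X₀ X₁ E) [CompleteSpace X₀] [CompleteSpace X₁] :
    CompleteSpace C.Sum :=
  inferInstanceAs (CompleteSpace (WithLp 1 (X₀ × X₁) ⧸ LinearMap.ker C.addMap))

/-- The embedding of `X₀ + X₁` in `E`. -/
def sumι (C : CompatibleCouple 𝕜 X₀ X₁ E) : C.Sum →ₗ[𝕜] E :=
  (LinearMap.ker C.addMap).liftQ C.addMap le_rfl

/-- The inclusion of `X₀ ∩ X₁` in `X₀ + X₁`. -/
def interToSum (C : CompatibleCouple 𝕜 X₀ X₁ E) (x : C.Inter) : C.Sum :=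
  (LinearMap.ker C.addMap).mkQ (WithLp.toLp 1 (x.1.1, 0))

end Sum

/-- Peetre's `K`-functional `K(f,t;X₀,X₁)`, the infimum of `‖f₀‖ + t ‖f₁‖` over all decompositions
`f = f₀ + f₁` (it is `∞` if `f ∉ X₀ + X₁`). -/
def K (C : CompatibleCouple 𝕜 X₀ X₁ E) (f : E) (t : ℝ) : ℝ≥0∞ :=
  ⨅ (p : X₀ × X₁) (_ : f = C.ι₀ p.1 + C.ι₁ p.2), ENNReal.ofReal (‖p.1‖ + t * ‖p.2‖)

/-- Peetre's `J`-functional `J(f,t;X₀,X₁) = max (‖f‖_{X₀}) (t ‖f‖_{X₁})` on `X₀ ∩ X₁`. -/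
def J (C : CompatibleCouple 𝕜 X₀ X₁ E) (f : C.Inter) (t : ℝ) : ℝ :=
  max ‖f.1.1‖ (t * ‖f.1.2‖)

/-- `‖f‖_{θ,q,v;K} = ‖t^(-θ-1/q) v(t) K(f,t)‖_{q,(0,∞)}`. -/
def kNorm (C : CompatibleCouple 𝕜 X₀ X₁ E) (θ : ℝ) (q : ℝ≥0∞) (v : ℝ → ℝ) (f : E) : ℝ≥0∞ :=
  eLpNorm (fun t : ℝ => ENNReal.ofReal (t ^ (-θ - (1 / q).toReal) * v t) * C.K f t) q
    (volume.restrict (Ioi 0))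

/-- The set of elements of `(X₀,X₁)_{θ,q,v;K}`, as a subset of `E`. -/
def kSpace (C : CompatibleCouple 𝕜 X₀ X₁ E) (θ : ℝ) (q : ℝ≥0∞) (v : ℝ → ℝ) : Set E :=
  {f | (∃ x₀ x₁, f = C.ι₀ x₀ + C.ι₁ x₁) ∧ C.kNorm θ q v f < ∞}

section J

variable [IsTopologicalAddGroup E] [T2Space E]

/-- `f = ∫₀^∞ u(s) ds/s` with `u : (0,∞) → X₀ ∩ X₁` strongly measurable and the integral
convergent in `X₀ + X₁` (Bochner integral). -/
structure IsRepresentation (C : CompatibleCouple 𝕜 X₀ X₁ E) (f : E) (u : ℝ → C.Inter) : Prop where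
  aestronglyMeasurable : AEStronglyMeasurable u (volume.restrict (Ioi 0))
  integrable : IntegrableOn (fun s : ℝ => s⁻¹ • C.interToSum (u s)) (Ioi 0)
  eq_integral : f = C.sumι (∫ s in Ioi (0 : ℝ), s⁻¹ • C.interToSum (u s))

/-- `‖f‖_{θ,q,v;J}`, the infimum of `‖t^(-θ-1/q) v(t) J(u(t),t)‖_{q,(0,∞)}` over all
representations `f = ∫₀^∞ u(s) ds/s` (it is `∞` if there are none). -/
def jNorm (C : CompatibleCouple 𝕜 X₀ X₁ E) (θ : ℝ) (q : ℝ≥0∞) (v : ℝ → ℝ) (f : E) : ℝ≥0∞ :=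
  ⨅ (u : ℝ → C.Inter) (_ : C.IsRepresentation f u),
    eLpNorm (fun t : ℝ => t ^ (-θ - (1 / q).toReal) * v t * C.J (u t) t) q
      (volume.restrict (Ioi 0))

/-- The set of elements of `(X₀,X₁)_{θ,q,v;J}`, as a subset of `E`. -/
def jSpace (C : CompatibleCouple 𝕜 X₀ X₁ E) (θ : ℝ) (q : ℝ≥0∞) (v : ℝ → ℝ) : Set E :=
  {f | C.jNorm θ q v f < ∞}

end J

end CompatibleCouple

/-- Two subspaces `S`, `T` of `E`, equipped with `N` and `M` respectively, coincide: they have the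
same elements and their norms are equivalent. -/
def Coincide {E : Type*} (S : Set E) (N : E → ℝ≥0∞) (T : Set E) (M : E → ℝ≥0∞) : Prop :=
  S = T ∧ ∃ c : ℝ, 0 < c ∧
    ∀ f ∈ S, N f ≤ ENNReal.ofReal c * M f ∧ M f ≤ ENNReal.ofReal c * N f

end

/-! Write p = q', μ = t⁻¹ A(t)^(-p) dt on (0,∞) and Φ(x) = μ((0,x]). The hypotheses make Φ finite,
continuous, positive and unbounded, so Φ carries μ to Lebesgue measure on (0,∞). All weights
disappear into μ: with g(t) = A(t)^p J(u(t),t), the weighted norm of J(u(t),t) is the L_q(μ) norm of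
g and ∫ J(u(s),s) ds/s = ∫ g dμ, while the K-norm with weight B is the L_q(μ) norm of K(f,·)/Φ.

From J to K (`exists_kNorm_le_jNorm`): cutting f = ∫ u ds/s at t bounds K(f,t) by ∫_(0,t] g dμ + t
∫_[t,∞) s⁻¹ g dμ. After division by Φ(t), the first term is controlled by Hardy's inequality for μ
and the second by Schur's test, through the slow variation of A. Here q > 1 is needed.

From K to J (`exists_jNorm_le_kNorm`): X₀ ∩ X₁ embeds contractively in X₀, so f lies in X₀ and the
trivial decomposition is optimal for t ≥ 1. Take points t_n with Φ(t_n) = 2Φ(1)2^(-n) and nearly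
optimal decompositions of f at t_(n+1). Differences of consecutive X₀-parts lie in the intersection
and telescope to f. Spreading each over an interval slightly nearer to 0 gives a representation
whose g is dominated by averages of K/Φ over a bounded range of values of Φ.

The two J-spaces (`exists_jNorm_interCouple_le`, `exists_jNorm_le_jNorm_interCouple`): the
J-functionals agree for t ≤ 1. Beyond 1, Hölder's inequality makes ∫ u ds/s converge in X₀ ∩ X₁ on
either side, so that part can be replaced by one element placed on (1,e], where every weight is
bounded. Hence A matters beyond 1 only through the finiteness and divergence properties of Φ. -/

/-- The measure `t⁻¹ b(t)^(-p) dt` on `(0,∞)`. -/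
noncomputable def weightMeasure (b : ℝ → ℝ) (p : ℝ) : Measure ℝ :=
  (volume.restrict (Ioi 0)).withDensity fun t => ENNReal.ofReal (t⁻¹ * b t ^ (-p))

/-! ### Absorbing weights into a measure -/

section WeightMeasure

variable {b : ℝ → ℝ} {p : ℝ}

theorem aemeasurable_weight (hb : AEMeasurable b (volume.restrict (Ioi 0))) :
    AEMeasurable (fun t => ENNReal.ofReal (t⁻¹ * b t ^ (-p))) (volume.restrict (Ioi 0)) :=
  (measurable_inv.aemeasurable.mul (hb.pow_const _)).ennreal_ofReal

theorem lintegral_weightMeasure (hb : AEMeasurable b (volume.restrict (Ioi 0)))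
    (h : ℝ → ℝ≥0∞) :
    ∫⁻ t, h t ∂weightMeasure b p =
      ∫⁻ t in Ioi 0, ENNReal.ofReal (t⁻¹ * b t ^ (-p)) * h t :=
  lintegral_withDensity_eq_lintegral_mul_non_measurable₀ _ (aemeasurable_weight hb)
    (Filter.Eventually.of_forall fun _ => ENNReal.ofReal_lt_top) _

theorem setLIntegral_weightMeasure (hb : AEMeasurable b (volume.restrict (Ioi 0)))
    (h : ℝ → ℝ≥0∞) {s : Set ℝ} (hs : MeasurableSet s) :
    ∫⁻ t in s, h t ∂weightMeasure b p =
      ∫⁻ t in s ∩ Ioi 0, ENNReal.ofReal (t⁻¹ * b t ^ (-p)) * h t := by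
  rw [← lintegral_indicator hs, lintegral_weightMeasure hb, ← Measure.restrict_restrict hs,
    ← lintegral_indicator hs]
  congr 1
  ext t
  by_cases ht : t ∈ s <;> simp [ht]

theorem weightMeasure_apply (hb : AEMeasurable b (volume.restrict (Ioi 0)))
    {s : Set ℝ} (hs : MeasurableSet s) :
    weightMeasure b p s = ∫⁻ t in s ∩ Ioi 0, ENNReal.ofReal (t⁻¹ * b t ^ (-p)) := by
  rw [← setLIntegral_one, setLIntegral_weightMeasure hb _ hs]
  simp

theorem weightMeasure_absolutelyContinuous :
    weightMeasure b p ≪ volume.restrict (Ioi 0) :=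
  withDensity_absolutelyContinuous _ _

theorem absolutelyContinuous_weightMeasure (hpos : ∀ t, 0 < t → 0 < b t)
    (hb : AEMeasurable b (volume.restrict (Ioi 0))) :
    volume.restrict (Ioi 0) ≪ weightMeasure b p := by
  refine withDensity_absolutelyContinuous' (aemeasurable_weight hb) ?_
  filter_upwards [ae_restrict_mem measurableSet_Ioi] with t ht
  have ht : 0 < t := ht
  have := Real.rpow_pos_of_pos (hpos t ht) (-p)
  simp only [ne_eq, ENNReal.ofReal_eq_zero, not_le]
  positivity

instance : SFinite (weightMeasure b p) := by
  unfold weightMeasure; infer_instance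

instance : NullSingletonClass (weightMeasure b p) := by
  unfold weightMeasure; infer_instance

/-- Change of measure for `L_q` norms, valid for `q = ∞` as well. -/
theorem eLpNorm_weightMeasure (hpos : ∀ t, 0 < t → 0 < b t)
    (hb : AEMeasurable b (volume.restrict (Ioi 0))) {q : ℝ≥0∞} (hq : q ≠ 0) (h : ℝ → ℝ≥0∞) :
    eLpNorm (fun t => ENNReal.ofReal ((t⁻¹ * b t ^ (-p)) ^ (1 / q).toReal) * h t) q
      (volume.restrict (Ioi 0)) = eLpNorm h q (weightMeasure b p) := by
  rcases eq_or_ne q ∞ with rfl | hq'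
  -- At q = ∞ the density is raised to the power 0, and the two essential suprema agree because the
  -- measures have the same null sets.
  · simp only [eLpNorm_exponent_top, eLpNormEssSup, enorm_eq_self, ENNReal.div_top,
      ENNReal.toReal_zero, Real.rpow_zero, ENNReal.ofReal_one, one_mul]
    exact le_antisymm (essSup_mono_measure (absolutelyContinuous_weightMeasure hpos hb))
      (essSup_mono_measure weightMeasure_absolutelyContinuous)
  · rw [eLpNorm_eq_lintegral_rpow_enorm_toReal hq hq',
      eLpNorm_eq_lintegral_rpow_enorm_toReal hq hq', lintegral_weightMeasure hb]
    congr 1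
    refine setLIntegral_congr_fun measurableSet_Ioi fun t ht => ?_
    have ht : 0 < t := ht
    have hq0 : 0 < q.toReal := ENNReal.toReal_pos hq hq'
    have hd : 0 ≤ t⁻¹ * b t ^ (-p) := by
      have := Real.rpow_pos_of_pos (hpos t ht) (-p)
      positivity
    simp only [enorm_eq_self]
    rw [ENNReal.mul_rpow_of_nonneg _ _ hq0.le, ENNReal.ofReal_rpow_of_nonneg (by positivity) hq0.le,
      ← Real.rpow_mul hd]
    simp [hq0.ne']

/-- The relation p/q + 1 = p is what splits t^(-1/q) b into the q-th root of the density times b^p.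
-/
theorem eLpNorm_rpow_mul_weight (hpos : ∀ t, 0 < t → 0 < b t)
    (hb : AEMeasurable b (volume.restrict (Ioi 0))) {q : ℝ≥0∞} (hq : q ≠ 0)
    (hp : (1 / q).toReal * p + 1 = p) (h : ℝ → ℝ≥0∞) :
    eLpNorm (fun t => ENNReal.ofReal (t ^ (-0 - (1 / q).toReal) * b t) * h t) q
      (volume.restrict (Ioi 0)) =
    eLpNorm (fun t => ENNReal.ofReal (b t ^ p) * h t) q (weightMeasure b p) := by
  rw [← eLpNorm_weightMeasure hpos hb hq]
  refine eLpNorm_congr_ae ?_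
  filter_upwards [ae_restrict_mem measurableSet_Ioi] with t ht
  have ht : 0 < t := ht
  have hbt := hpos t ht
  rw [← mul_assoc, ← ENNReal.ofReal_mul (by positivity)]
  congr 2
  rw [Real.mul_rpow (by positivity) (by positivity), Real.inv_rpow ht.le, ← Real.rpow_mul hbt.le,
    mul_assoc, ← Real.rpow_add hbt, ← Real.rpow_neg ht.le]
  congr 1
  · congr 1; ring
  · rw [show -p * (1 / q).toReal + p = 1 by linarith, Real.rpow_one]

/-- The same factor b^p turns ds/s into the weighted measure, so one function serves both for the
norm and for the integral representing f. -/
theorem setLIntegral_inv_mul (hpos : ∀ t, 0 < t → 0 < b t)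
    (hb : AEMeasurable b (volume.restrict (Ioi 0))) (h : ℝ → ℝ≥0∞) {s : Set ℝ}
    (hs : MeasurableSet s) :
    ∫⁻ t in s ∩ Ioi 0, ENNReal.ofReal t⁻¹ * h t =
      ∫⁻ t in s, ENNReal.ofReal (b t ^ p) * h t ∂weightMeasure b p := by
  rw [setLIntegral_weightMeasure hb _ hs]
  refine setLIntegral_congr_fun (hs.inter measurableSet_Ioi) fun t ht => ?_
  have ht : 0 < t := ht.2
  have hbt := hpos t ht
  rw [← mul_assoc, ← ENNReal.ofReal_mul (by positivity), mul_assoc t⁻¹, ← Real.rpow_add hbt]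
  simp

/-- Hölder's inequality for the measure `ds/s`. -/
theorem setLIntegral_inv_mul_le (hpos : ∀ t, 0 < t → 0 < b t)
    (hb : AEMeasurable b (volume.restrict (Ioi 0))) {q : ℝ≥0∞} (hq : 1 ≤ q)
    (hp : (1 / q).toReal * p + 1 = p) {h : ℝ → ℝ≥0∞}
    (hh : AEMeasurable h (volume.restrict (Ioi 0))) {s : Set ℝ} (hs : MeasurableSet s) :
    ∫⁻ t in s ∩ Ioi 0, ENNReal.ofReal t⁻¹ * h t ≤
      eLpNorm (fun t => ENNReal.ofReal (t ^ (-0 - (1 / q).toReal) * b t) * h t) q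
        (volume.restrict (Ioi 0)) * weightMeasure b p s ^ (1 - (1 / q).toReal) := by
  have hg : AEMeasurable (fun t => ENNReal.ofReal (b t ^ p) * h t) (weightMeasure b p) :=
    ((hb.pow_const _).ennreal_ofReal.mul hh).mono_ac weightMeasure_absolutelyContinuous
  rw [eLpNorm_rpow_mul_weight hpos hb (by positivity) hp, setLIntegral_inv_mul hpos hb h hs]
  -- Hölder against the constant 1 over `s`, applied to b^p h.
  have := eLpNorm_le_eLpNorm_mul_rpow_measure_univ (μ := (weightMeasure b p).restrict s) hq
    hg.restrict.aestronglyMeasurable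
  rw [eLpNorm_one_eq_lintegral_enorm] at this
  simp only [enorm_eq_self, ENNReal.toReal_one, Measure.restrict_apply_univ, div_one] at this
  refine this.trans ?_
  rw [show (1 / q).toReal = 1 / q.toReal by simp]
  gcongr
  exact Measure.restrict_le_self

end WeightMeasure

/-! ### Schur's test in L_q -/

section Schur

variable {α : Type*} [MeasurableSpace α] {μ : Measure α} [SFinite μ]

/-- Schur's test with a weight `w`. -/
theorem lintegral_rpow_kernel_le {p r : ℝ} (hpr : r.HolderConjugate p) {k : α → α → ℝ≥0∞}
    (hk : Measurable (Function.uncurry k)) {w : α → ℝ≥0∞} (hw : Measurable w)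
    (hw0 : ∀ᵐ x ∂μ, w x ≠ 0 ∧ w x ≠ ∞) {C₁ C₂ : ℝ≥0∞}
    (h₁ : ∀ᵐ t ∂μ, ∫⁻ s, k t s * w s ^ p ∂μ ≤ C₁ * w t ^ p)
    (h₂ : ∀ᵐ s ∂μ, ∫⁻ t, k t s * w t ^ r ∂μ ≤ C₂ * w s ^ r)
    {g : α → ℝ≥0∞} (hg : AEMeasurable g μ) :
    ∫⁻ t, (∫⁻ s, k t s * g s ∂μ) ^ r ∂μ ≤ C₁ ^ (r / p) * C₂ * ∫⁻ s, g s ^ r ∂μ := by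
  have hr0 := hpr.pos
  have hp0 := hpr.symm.pos
  have hkt : ∀ t, Measurable (k t) := fun t => hk.of_uncurry_left
  -- Hölder for k g = (k^(1/r) w⁻¹ g)(k^(1/p) w); `h₁` bounds the second factor. Tonelli and `h₂`
  -- then finish the estimate.
  have holder : ∀ᵐ t ∂μ, (∫⁻ s, k t s * g s ∂μ) ^ r ≤
      C₁ ^ (r / p) * ∫⁻ s, w t ^ r * k t s * (w s ^ (-r) * g s ^ r) ∂μ := by
    filter_upwards [h₁] with t ht
    have e1 : ∫⁻ s, k t s * g s ∂μ =
        ∫⁻ s, ((fun s => k t s ^ (1 / r) * ((w s)⁻¹ * g s)) * fun s => k t s ^ (1 / p) * w s) s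
          ∂μ := by
      refine lintegral_congr_ae ?_
      filter_upwards [hw0] with s hs
      simp only [Pi.mul_apply]
      rw [show k t s ^ (1 / r) * ((w s)⁻¹ * g s) * (k t s ^ (1 / p) * w s) =
        k t s ^ (1 / r) * k t s ^ (1 / p) * ((w s)⁻¹ * w s) * g s by ring,
        ← ENNReal.rpow_add_of_nonneg _ _ (by positivity) (by positivity),
        ENNReal.inv_mul_cancel hs.1 hs.2]
      have := hpr.inv_add_inv_eq_one
      simp [one_div, this]
    have e2 := ENNReal.lintegral_mul_le_Lp_mul_Lq μ hpr
      (f := fun s => k t s ^ (1 / r) * ((w s)⁻¹ * g s)) (g := fun s => k t s ^ (1 / p) * w s)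
      (((hkt t).pow_const _).aemeasurable.mul (hw.inv.aemeasurable.mul hg))
      (((hkt t).pow_const _).mul hw).aemeasurable
    rw [← e1] at e2
    simp only [ENNReal.mul_rpow_of_nonneg _ _ hr0.le, ENNReal.mul_rpow_of_nonneg _ _ hp0.le,
      ← ENNReal.rpow_mul, one_div, inv_mul_cancel₀ hr0.ne', inv_mul_cancel₀ hp0.ne',
      ENNReal.rpow_one, ENNReal.inv_rpow, ← ENNReal.rpow_neg] at e2
    calc (∫⁻ s, k t s * g s ∂μ) ^ r
        ≤ ((∫⁻ s, k t s * (w s ^ (-r) * g s ^ r) ∂μ) ^ r⁻¹ *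
            (C₁ * w t ^ p) ^ p⁻¹) ^ r := by
          refine ENNReal.rpow_le_rpow (e2.trans ?_) hr0.le
          gcongr
      _ = C₁ ^ (r / p) * (w t ^ r * ∫⁻ s, k t s * (w s ^ (-r) * g s ^ r) ∂μ) := by
          rw [ENNReal.mul_rpow_of_nonneg _ _ hr0.le, ENNReal.mul_rpow_of_nonneg _ _
            (by positivity : (0:ℝ) ≤ p⁻¹), ENNReal.mul_rpow_of_nonneg _ _ hr0.le,
            ← ENNReal.rpow_mul, ← ENNReal.rpow_mul, ← ENNReal.rpow_mul, ← ENNReal.rpow_mul,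
            inv_mul_cancel₀ hr0.ne', ENNReal.rpow_one, show p⁻¹ * r = r / p by ring,
            mul_div_cancel₀ _ hp0.ne']
          ring
      _ = _ := by
          congr 1
          rw [← lintegral_const_mul'']
          · simp only [mul_assoc]
          · exact (hkt t).aemeasurable.mul ((hw.pow_const _).aemeasurable.mul (hg.pow_const _))
  have hm : AEMeasurable (Function.uncurry fun t s => w t ^ r * k t s * (w s ^ (-r) * g s ^ r))
      (μ.prod μ) := by
    have hgs : AEMeasurable (fun z : α × α => g z.2) (μ.prod μ) := hg.comp_snd
    exact ((((hw.pow_const _).comp measurable_fst).mul hk).aemeasurable).mul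
      (((hw.pow_const _).comp measurable_snd).aemeasurable.mul (hgs.pow_const _))
  calc ∫⁻ t, (∫⁻ s, k t s * g s ∂μ) ^ r ∂μ
      ≤ ∫⁻ t, C₁ ^ (r / p) * ∫⁻ s, w t ^ r * k t s * (w s ^ (-r) * g s ^ r) ∂μ ∂μ :=
        lintegral_mono_ae holder
    _ = C₁ ^ (r / p) * ∫⁻ s, ∫⁻ t, w t ^ r * k t s * (w s ^ (-r) * g s ^ r) ∂μ ∂μ := by
        rw [lintegral_const_mul'', lintegral_lintegral_swap hm]
        exact hm.lintegral_prod_right'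
    _ ≤ C₁ ^ (r / p) * ∫⁻ s, C₂ * g s ^ r ∂μ := by
        refine mul_le_mul' le_rfl (lintegral_mono_ae ?_)
        filter_upwards [h₂, hw0] with s hs hs0
        have hks : Measurable fun t => k t s := hk.of_uncurry_right
        have hwk : Measurable fun t => w t ^ r * k t s := (hw.pow_const r).mul hks
        rw [lintegral_mul_const _ hwk]
        simp only [mul_comm (w _ ^ r)]
        calc _ ≤ C₂ * w s ^ r * (w s ^ (-r) * g s ^ r) := by gcongr
          _ = C₂ * (w s ^ r * w s ^ (-r)) * g s ^ r := by ring
          _ = _ := by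
            rw [← ENNReal.rpow_add _ _ hs0.1 hs0.2]; simp
    _ = _ := by
        rw [lintegral_const_mul'' _ (hg.pow_const _), mul_assoc]

/-- Schur's test in `L_q`, `1 < q ≤ ∞`, for a kernel with bounded marginals. -/
theorem eLpNorm_kernel_le {q : ℝ≥0∞} (hq : 1 < q) {k : α → α → ℝ≥0∞}
    (hk : Measurable (Function.uncurry k)) {C : ℝ≥0∞}
    (h₁ : ∀ᵐ t ∂μ, ∫⁻ s, k t s ∂μ ≤ C) (h₂ : ∀ᵐ s ∂μ, ∫⁻ t, k t s ∂μ ≤ C)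
    {g : α → ℝ≥0∞} (hg : AEMeasurable g μ) :
    eLpNorm (fun t => ∫⁻ s, k t s * g s ∂μ) q μ ≤ C * eLpNorm g q μ := by
  rcases eq_or_ne q ∞ with rfl | hq'
  · simp only [eLpNorm_exponent_top, eLpNormEssSup, enorm_eq_self]
    refine essSup_le_of_ae_le _ ?_
    filter_upwards [h₁] with t ht
    calc ∫⁻ s, k t s * g s ∂μ ≤ ∫⁻ s, k t s * essSup g μ ∂μ := by
          refine lintegral_mono_ae ?_
          filter_upwards [ENNReal.ae_le_essSup g] with s hs
          gcongr
      _ = (∫⁻ s, k t s ∂μ) * essSup g μ := lintegral_mul_const _ hk.of_uncurry_left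
      _ ≤ _ := by gcongr
  · have hq1 : 1 < q.toReal := by
      rwa [← ENNReal.toReal_one, ENNReal.toReal_lt_toReal ENNReal.one_ne_top hq']
    have hc := Real.HolderConjugate.conjExponent hq1
    have hq0 := hc.pos
    have := lintegral_rpow_kernel_le hc hk (w := fun _ => 1) measurable_const
      (by simp) (C₁ := C) (C₂ := C) (by simpa using h₁) (by simpa using h₂) hg
    rw [eLpNorm_eq_lintegral_rpow_enorm_toReal (by positivity) hq',
      eLpNorm_eq_lintegral_rpow_enorm_toReal (by positivity) hq']
    simp only [enorm_eq_self]
    calc _ ≤ (C ^ (q.toReal / q.toReal.conjExponent) * C * ∫⁻ s, g s ^ q.toReal ∂μ) ^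
          (1 / q.toReal) := by gcongr
      _ = _ := by
        have e : C ^ (q.toReal / q.toReal.conjExponent) * C = C ^ q.toReal := by
          conv_lhs => rw [← ENNReal.rpow_one C, ← ENNReal.rpow_mul]
          rw [← ENNReal.rpow_add_of_nonneg _ _ (by have := hc.symm.pos; positivity) zero_le_one]
          congr 1
          have h3 := hc.inv_add_inv_eq_one
          have : q.toReal.conjExponent ≠ 0 := hc.symm.pos.ne'
          field_simp at h3 ⊢
          linarith
        rw [e, ENNReal.mul_rpow_of_nonneg _ _ (by positivity), ← ENNReal.rpow_mul,
          mul_one_div_cancel hq0.ne', ENNReal.rpow_one]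

end Schur

/-! ### Growth of slowly varying functions and two power integrals -/

/-- A slowly varying function is, up to a constant, dominated at `t` by `(s/t)^ε` times its value at
any `s ≥ t`. -/
theorem SlowlyVarying.exists_le_mul_rpow {b : ℝ → ℝ} (hb : SlowlyVarying b) {ε : ℝ} (hε : 0 < ε) :
    ∃ C : ℝ, 0 < C ∧ ∀ t s, 0 < t → t ≤ s → b t ≤ C * (s / t) ^ ε * b s := by
  obtain ⟨g, hg, c, hc, hcg⟩ := hb.monotone ε hε
  refine ⟨c * c, by positivity, fun t s ht hts => ?_⟩
  have hs := ht.trans_le hts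
  have h1 := (hcg t ht).1
  have h2 := hg ht hs hts
  have h3 := (hcg s hs).2
  have h4 : t ^ ε * b t ≤ c * (c * (s ^ ε * b s)) :=
    h1.trans (mul_le_mul_of_nonneg_left (h2.trans h3) hc.le)
  have ht' : 0 < t ^ ε := Real.rpow_pos_of_pos ht _
  rw [Real.div_rpow hs.le ht.le]
  rw [show c * c * (s ^ ε / t ^ ε) * b s = c * (c * (s ^ ε * b s)) / t ^ ε by ring,
    le_div_iff₀ ht', mul_comm]
  exact h4

/-- Any exponent below 1 would serve later: it only has to leave s^(-2) integrable at infinity after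
multiplication. The value 1/2 comes from ε = 1/(2p). -/
theorem SlowlyVarying.exists_rpow_neg_le {b : ℝ → ℝ} (hb : SlowlyVarying b) {p : ℝ} (hp : 0 < p) :
    ∃ C : ℝ, 0 < C ∧ ∀ t s, 0 < t → t ≤ s →
      b s ^ (-p) ≤ C * (s / t) ^ (1 / 2 : ℝ) * b t ^ (-p) := by
  obtain ⟨C, hC, h⟩ := hb.exists_le_mul_rpow (ε := 1 / (2 * p)) (by positivity)
  refine ⟨C ^ p, by positivity, fun t s ht hts => ?_⟩
  have hs := ht.trans_le hts
  have hbt := hb.pos t ht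
  have hbs := hb.pos s hs
  have h1 := Real.rpow_le_rpow hbt.le (h t s ht hts) hp.le
  rw [Real.mul_rpow (by positivity) hbs.le, Real.mul_rpow hC.le (by positivity),
    ← Real.rpow_mul (by positivity), show 1 / (2 * p) * p = 1 / 2 by field_simp] at h1
  rw [Real.rpow_neg hbs.le, Real.rpow_neg hbt.le, inv_le_iff_one_le_mul₀ (by positivity)]
  rw [show C ^ p * (s / t) ^ (1 / 2 : ℝ) * (b t ^ p)⁻¹ * b s ^ p =
    C ^ p * (s / t) ^ (1 / 2 : ℝ) * b s ^ p / b t ^ p by ring, le_div_iff₀ (by positivity)]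
  linarith

theorem lintegral_Ioc_rpow_neg_half {b : ℝ} (hb : 0 < b) :
    ∫⁻ y in Ioc 0 b, ENNReal.ofReal y ^ (-(1 / 2) : ℝ) = 2 * ENNReal.ofReal b ^ (1 / 2 : ℝ) := by
  have h1 : ∫⁻ y in Ioc 0 b, ENNReal.ofReal y ^ (-(1 / 2) : ℝ) =
      ∫⁻ y in Ioc 0 b, ENNReal.ofReal (y ^ (-(1 / 2) : ℝ)) :=
    setLIntegral_congr_fun measurableSet_Ioc fun y hy => ENNReal.ofReal_rpow_of_pos hy.1
  have hi : IntegrableOn (fun y : ℝ => y ^ (-(1 / 2) : ℝ)) (Ioc 0 b) := by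
    rw [← intervalIntegrable_iff_integrableOn_Ioc_of_le hb.le]
    exact intervalIntegral.intervalIntegrable_rpow' (by norm_num)
  rw [h1, ← ofReal_integral_eq_lintegral_ofReal hi, ← intervalIntegral.integral_of_le hb.le,
    integral_rpow (Or.inl (by norm_num)), ENNReal.ofReal_rpow_of_pos hb,
    ← ENNReal.ofReal_ofNat 2, ← ENNReal.ofReal_mul (by norm_num)]
  · congr 1
    norm_num
    ring
  · filter_upwards [ae_restrict_mem measurableSet_Ioc] with y hy
    exact Real.rpow_nonneg hy.1.le _

theorem lintegral_Ici_rpow_neg {b e : ℝ} (hb : 0 < b) (he : 0 < e) :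
    ∫⁻ y in Ici b, ENNReal.ofReal (y ^ (-1 - e)) = ENNReal.ofReal (b ^ (-e) / e) := by
  rw [setLIntegral_congr Ioi_ae_eq_Ici.symm, ← ofReal_integral_eq_lintegral_ofReal
    (integrableOn_Ioi_rpow_of_lt (by linarith) hb), integral_Ioi_rpow_of_lt (by linarith) hb]
  · congr 1
    rw [show -1 - e + 1 = -e by ring, div_neg, neg_div, neg_neg]
  · filter_upwards [ae_restrict_mem measurableSet_Ioi] with y hy
    exact Real.rpow_nonneg (hb.trans hy).le _

/-! ### Atomless measures on the half-line and Hardy's inequality -/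

/-- A measure on `(0,∞)` which is finite, positive on `(0,x]` for every `x > 0`, and infinite on
`(0,∞)`. -/
structure IsHalfLineMeasure (μ : Measure ℝ) : Prop where
  zero : μ (Iic 0) = 0
  lt_top : ∀ x, μ (Iic x) < ∞
  pos : ∀ x, 0 < x → 0 < μ (Iic x)
  univ : μ univ = ∞

namespace IsHalfLineMeasure

variable {μ : Measure ℝ}

theorem monotone_real_Iic (hμ : IsHalfLineMeasure μ) : Monotone fun x => μ.real (Iic x) :=
  fun _ _ h => measureReal_mono (Iic_subset_Iic.2 h) (hμ.lt_top _).ne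

theorem ofReal_real_Iic (hμ : IsHalfLineMeasure μ) (x : ℝ) :
    ENNReal.ofReal (μ.real (Iic x)) = μ (Iic x) :=
  ofReal_measureReal (hμ.lt_top x).ne

theorem real_Iic_pos (hμ : IsHalfLineMeasure μ) {x : ℝ} (hx : 0 < x) : 0 < μ.real (Iic x) :=
  ENNReal.toReal_pos (hμ.pos x hx).ne' (hμ.lt_top x).ne

theorem real_Iic_nonpos (hμ : IsHalfLineMeasure μ) {x : ℝ} (hx : x ≤ 0) : μ.real (Iic x) = 0 := by
  simp [Measure.real, measure_mono_null (Iic_subset_Iic.2 hx) hμ.zero]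

/-- Without atoms, the distribution function is a continuous primitive of the constant 1. -/
theorem continuous_real_Iic [NullSingletonClass μ] (hμ : IsHalfLineMeasure μ) :
    Continuous fun x => μ.real (Iic x) := by
  have hi : ∀ a, IntegrableOn (fun _ => (1 : ℝ)) (Iic a) μ := fun a =>
    integrableOn_const (hμ.lt_top a).ne
  have h : (fun x => μ.real (Iic x)) = fun x => ∫ _ in (0 : ℝ)..x, (1 : ℝ) ∂μ := by
    ext x
    rw [← intervalIntegral.integral_Iic_sub_Iic (hi 0) (hi x)]
    simp [hμ.real_Iic_nonpos le_rfl]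
  rw [h]
  refine intervalIntegral.continuous_primitive (fun a b => ?_) 0
  rw [intervalIntegrable_iff]
  exact (hi (max a b)).mono_set Ioc_subset_Iic_self

theorem tendsto_real_Iic (hμ : IsHalfLineMeasure μ) :
    Filter.Tendsto (fun x => μ.real (Iic x)) Filter.atTop Filter.atTop := by
  have h := tendsto_measure_Iic_atTop μ
  rw [hμ.univ] at h
  rw [Filter.tendsto_atTop]
  intro b
  filter_upwards [(ENNReal.tendsto_nhds_top_iff_nnreal.1 h) b.toNNReal] with x hx
  rw [← hμ.ofReal_real_Iic] at hx
  exact (Real.le_coe_toNNReal b).trans (by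
    simpa using (ENNReal.ofReal_le_ofReal_iff measureReal_nonneg).1 hx.le)

/-- The point is the supremum of the sublevel set, which is closed by continuity and bounded because
the total mass is infinite; the intermediate value theorem shows that the level is attained.
Choosing the largest solution handles possible flat pieces. -/
theorem exists_real_Iic_eq [NullSingletonClass μ] (hμ : IsHalfLineMeasure μ) {y : ℝ} (hy : 0 ≤ y) :
    ∃ x, 0 ≤ x ∧ μ.real (Iic x) = y ∧ {s | μ.real (Iic s) ≤ y} = Iic x := by
  set S := {s | μ.real (Iic s) ≤ y} with hS
  have hc : IsClosed S := isClosed_le hμ.continuous_real_Iic continuous_const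
  have h0 : (0 : ℝ) ∈ S := by simp [hS, hμ.real_Iic_nonpos le_rfl, hy]
  obtain ⟨M, hM⟩ := (hμ.tendsto_real_Iic.eventually_gt_atTop y).exists
  have hbd : BddAbove S := ⟨M, fun s hs => le_of_not_gt fun hlt =>
    absurd (hμ.monotone_real_Iic hlt.le) (not_le.2 (lt_of_le_of_lt hs hM))⟩
  have hm : sSup S ∈ S := hc.csSup_mem ⟨0, h0⟩ hbd
  have h0' : 0 ≤ sSup S := le_csSup hbd h0
  refine ⟨sSup S, h0', le_antisymm hm ?_, ?_⟩
  · have hM0 : (0 : ℝ) ≤ M := le_of_not_gt fun h => by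
      rw [hμ.real_Iic_nonpos h.le] at hM; linarith
    obtain ⟨z, -, hz⟩ := intermediate_value_Icc hM0 hμ.continuous_real_Iic.continuousOn
      (show y ∈ Icc (μ.real (Iic 0)) (μ.real (Iic M)) from
        ⟨by rw [hμ.real_Iic_nonpos le_rfl]; exact hy, hM.le⟩)
    rw [← hz]
    exact hμ.monotone_real_Iic (le_csSup hbd hz.le)
  · ext s
    exact ⟨fun hs => le_csSup hbd hs, fun hs => (hμ.monotone_real_Iic hs).trans hm⟩

theorem measure_real_Iic_le [NullSingletonClass μ] (hμ : IsHalfLineMeasure μ) (y : ℝ) :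
    μ {s | μ.real (Iic s) ≤ y} = ENNReal.ofReal y := by
  rcases lt_or_ge y 0 with hy | hy
  · have : {s | μ.real (Iic s) ≤ y} = ∅ := by
      ext s
      simpa using hy.trans_le measureReal_nonneg
    simp [this, ENNReal.ofReal_of_nonpos hy.le]
  · obtain ⟨x, -, hx, hS⟩ := hμ.exists_real_Iic_eq hy
    rw [hS, ← hx, hμ.ofReal_real_Iic]

/-- The distribution function carries the measure to Lebesgue measure. -/
theorem map_real_Iic [NullSingletonClass μ] (hμ : IsHalfLineMeasure μ) :
    μ.map (fun x => μ.real (Iic x)) = volume.restrict (Ioi 0) := by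
  have hmeas := hμ.monotone_real_Iic.measurable
  have key : ∀ ⦃a b : ℝ⦄, a < b → μ.map (fun x => μ.real (Iic x)) (Ioc a b) =
      ENNReal.ofReal b - ENNReal.ofReal a := fun a b hab => by
    rw [Measure.map_apply hmeas measurableSet_Ioc,
      show Ioc a b = Iic b \ Iic a by ext x; simp [and_comm], preimage_sdiff,
      measure_sdiff (preimage_mono (Iic_subset_Iic.2 hab.le))
        (hmeas measurableSet_Iic).nullMeasurableSet]
    · exact congrArg₂ _ (hμ.measure_real_Iic_le b) (hμ.measure_real_Iic_le a)
    · exact (hμ.measure_real_Iic_le a).trans_ne ENNReal.ofReal_ne_top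
  refine Measure.ext_of_Ioc' _ _ (fun a b hab => ?_) fun a b hab => ?_
  · rw [key hab]
    exact ENNReal.sub_ne_top ENNReal.ofReal_ne_top
  · rw [key hab, Measure.restrict_apply measurableSet_Ioc, Ioc_inter_Ioi, Real.volume_Ioc]
    rcases le_total a 0 with ha | ha
    · simp [ha, ENNReal.ofReal_of_nonpos ha]
    · simp [ha, ENNReal.ofReal_sub b ha]

theorem lintegral_comp_real_Iic [NullSingletonClass μ] (hμ : IsHalfLineMeasure μ) {φ : ℝ → ℝ≥0∞}
    (hφ : Measurable φ) : ∫⁻ s, φ (μ.real (Iic s)) ∂μ = ∫⁻ y in Ioi 0, φ y := by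
  rw [← hμ.map_real_Iic, lintegral_map hφ hμ.monotone_real_Iic.measurable]

theorem ae_pos (hμ : IsHalfLineMeasure μ) : ∀ᵐ t ∂μ, 0 < t := by
  rw [ae_iff]
  simpa [Iic] using hμ.zero

theorem measurable_Iic (μ : Measure ℝ) : Measurable fun t => μ (Iic t) :=
  Monotone.measurable fun _ _ h => measure_mono (Iic_subset_Iic.2 h)

/-- Substituting y = Φ(s) bounds the left side by the integral of y^(-1/2) over (0, Φ(t)]. Only an
inequality is claimed, since Φ(s) ≤ Φ(t) need not force s ≤ t. -/
theorem lintegral_Iic_rpow_neg_half_le [NullSingletonClass μ] (hμ : IsHalfLineMeasure μ) {t : ℝ}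
    (ht : 0 < t) :
    ∫⁻ s in Iic t, μ (Iic s) ^ (-(1 / 2) : ℝ) ∂μ ≤ 2 * μ (Iic t) ^ (1 / 2 : ℝ) := by
  have hφ : Measurable ((Iic (μ.real (Iic t))).indicator
      fun y => ENNReal.ofReal y ^ (-(1 / 2) : ℝ)) :=
    (ENNReal.measurable_ofReal.pow_const _).indicator measurableSet_Iic
  calc ∫⁻ s in Iic t, μ (Iic s) ^ (-(1 / 2) : ℝ) ∂μ
      ≤ ∫⁻ s, (Iic (μ.real (Iic t))).indicator (fun y => ENNReal.ofReal y ^ (-(1 / 2) : ℝ))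
          (μ.real (Iic s)) ∂μ := by
        rw [← lintegral_indicator measurableSet_Iic]
        refine lintegral_mono fun s => ?_
        by_cases hs : s ∈ Iic t
        · have : μ.real (Iic s) ∈ Iic (μ.real (Iic t)) := hμ.monotone_real_Iic hs
          rw [indicator_of_mem hs, indicator_of_mem this, hμ.ofReal_real_Iic]
        · simp [indicator_of_notMem hs]
    _ = 2 * μ (Iic t) ^ (1 / 2 : ℝ) := by
        rw [hμ.lintegral_comp_real_Iic hφ, setLIntegral_indicator measurableSet_Iic,
          inter_comm, Ioi_inter_Iic, lintegral_Ioc_rpow_neg_half (hμ.real_Iic_pos ht),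
          hμ.ofReal_real_Iic]

/-- The same substitution leads to the integral of y^(-1-e) over [Φ(t), ∞). -/
theorem lintegral_Ici_rpow_neg_le [NullSingletonClass μ] (hμ : IsHalfLineMeasure μ) {t e : ℝ}
    (ht : 0 < t) (he : 0 < e) :
    ∫⁻ s in Ici t, μ (Iic s) ^ (-1 - e) ∂μ ≤ ENNReal.ofReal (1 / e) * μ (Iic t) ^ (-e) := by
  have hφ : Measurable ((Ici (μ.real (Iic t))).indicator
      fun y => ENNReal.ofReal (y ^ (-1 - e))) :=
    (measurable_id.pow_const _).ennreal_ofReal.indicator measurableSet_Ici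
  have ht' := hμ.real_Iic_pos ht
  calc ∫⁻ s in Ici t, μ (Iic s) ^ (-1 - e) ∂μ
      ≤ ∫⁻ s, (Ici (μ.real (Iic t))).indicator (fun y => ENNReal.ofReal (y ^ (-1 - e)))
          (μ.real (Iic s)) ∂μ := by
        rw [← lintegral_indicator measurableSet_Ici]
        refine lintegral_mono fun s => ?_
        by_cases hs : s ∈ Ici t
        · have : μ.real (Iic s) ∈ Ici (μ.real (Iic t)) := hμ.monotone_real_Iic hs
          rw [indicator_of_mem hs, indicator_of_mem this, ← hμ.ofReal_real_Iic,
            ENNReal.ofReal_rpow_of_pos (hμ.real_Iic_pos (ht.trans_le hs))]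
        · simp [indicator_of_notMem hs]
    _ = ENNReal.ofReal (1 / e) * μ (Iic t) ^ (-e) := by
        rw [hμ.lintegral_comp_real_Iic hφ, setLIntegral_indicator measurableSet_Ici,
          inter_eq_left.2 (Ici_subset_Ioi.2 ht'), lintegral_Ici_rpow_neg ht' he,
          ← hμ.ofReal_real_Iic t, ENNReal.ofReal_rpow_of_pos ht',
          ← ENNReal.ofReal_mul (by positivity)]
        congr 1
        ring

theorem measurable_kernel_Iic {φ : ℝ → ℝ≥0∞} (hφ : Measurable φ) :
    Measurable (Function.uncurry fun t s : ℝ => (Iic t).indicator (fun _ => φ t) s) := by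
  have : (Function.uncurry fun t s : ℝ => (Iic t).indicator (fun _ => φ t) s) =
      {z : ℝ × ℝ | z.2 ≤ z.1}.indicator fun z => φ z.1 := by
    ext ⟨t, s⟩
    by_cases h : s ≤ t <;> simp [indicator, h]
  rw [this]
  exact (hφ.comp measurable_fst).indicator (measurableSet_le measurable_snd measurable_fst)

/-- Hardy's inequality. -/
theorem exists_eLpNorm_average_le [NullSingletonClass μ] [SFinite μ] (hμ : IsHalfLineMeasure μ)
    {q : ℝ≥0∞} (hq : 1 < q) :
    ∃ C : ℝ≥0∞, C ≠ ∞ ∧ ∀ g : ℝ → ℝ≥0∞, AEMeasurable g μ →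
      eLpNorm (fun t => (μ (Iic t))⁻¹ * ∫⁻ s in Iic t, g s ∂μ) q μ ≤ C * eLpNorm g q μ := by
  rcases eq_or_ne q ∞ with rfl | hq'
  · refine ⟨1, ENNReal.one_ne_top, fun g hg => ?_⟩
    simp only [eLpNorm_exponent_top, eLpNormEssSup, enorm_eq_self, one_mul]
    refine essSup_le_of_ae_le _ ?_
    filter_upwards [hμ.ae_pos] with t ht
    calc (μ (Iic t))⁻¹ * ∫⁻ s in Iic t, g s ∂μ
        ≤ (μ (Iic t))⁻¹ * ∫⁻ _ in Iic t, essSup g μ ∂μ := by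
          refine mul_le_mul' le_rfl (lintegral_mono_ae ?_)
          filter_upwards [ae_restrict_of_ae (ENNReal.ae_le_essSup g)] with s hs using hs
      _ = essSup g μ := by
          rw [setLIntegral_const, mul_comm (essSup g μ), ← mul_assoc,
            ENNReal.inv_mul_cancel (hμ.pos t ht).ne' (hμ.lt_top t).ne, one_mul]
  · have hq1 : 1 < q.toReal := by
      rwa [← ENNReal.toReal_one, ENNReal.toReal_lt_toReal ENNReal.one_ne_top hq']
    have hc := Real.HolderConjugate.conjExponent hq1
    set r := q.toReal
    set p := r.conjExponent
    have hr0 := hc.pos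
    have hp0 := hc.symm.pos
    -- The Schur weight is w = Φ^(-1/(2p)). Then w^p = Φ^(-1/2) is integrable near 0, giving `C₁ =
    -- 2`, and w^r = Φ^(-e) adds to Φ⁻¹ the decay that makes the other marginal finite, giving `C₂ =
    -- 1/e`.
    set e := r / (2 * p) with he
    have he0 : 0 < e := by positivity
    have hmI := measurable_Iic μ
    have hne : ∀ᵐ t ∂μ, μ (Iic t) ≠ 0 ∧ μ (Iic t) ≠ ∞ := by
      filter_upwards [hμ.ae_pos] with t ht using ⟨(hμ.pos t ht).ne', (hμ.lt_top t).ne⟩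
    have hS : ∀ g : ℝ → ℝ≥0∞, AEMeasurable g μ → _ := fun g hg =>
      lintegral_rpow_kernel_le (μ := μ) hc
      (k := fun t s => (Iic t).indicator (fun _ => (μ (Iic t))⁻¹) s)
      (measurable_kernel_Iic hmI.inv) (w := fun s => μ (Iic s) ^ (-(1 / (2 * p)))) (hmI.pow_const _)
      (by
        filter_upwards [hne] with t ht
        exact ⟨(ENNReal.rpow_pos (pos_iff_ne_zero.2 ht.1) ht.2).ne',
          ENNReal.rpow_ne_top_of_ne_zero ht.1 ht.2⟩)
      (C₁ := 2) (C₂ := ENNReal.ofReal (1 / e))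
      (by
        filter_upwards [hne, hμ.ae_pos] with t ht ht0
        have : ∀ s, (Iic t).indicator (fun _ => (μ (Iic t))⁻¹) s *
            (μ (Iic s) ^ (-(1 / (2 * p)))) ^ p =
            (Iic t).indicator (fun s => (μ (Iic t))⁻¹ * μ (Iic s) ^ (-(1 / 2) : ℝ)) s := by
          intro s
          rw [← ENNReal.rpow_mul, show -(1 / (2 * p)) * p = -(1 / 2) by field_simp]
          by_cases hs : s ∈ Iic t <;> simp [indicator_of_mem, indicator_of_notMem, hs]
        simp only [this]
        rw [lintegral_indicator measurableSet_Iic, lintegral_const_mul _ (hmI.pow_const _),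
          ← ENNReal.rpow_mul, show -(1 / (2 * p)) * p = -1 + 1 / 2 by field_simp; norm_num,
          ENNReal.rpow_add _ _ ht.1 ht.2, ENNReal.rpow_neg_one, mul_left_comm]
        exact mul_le_mul' le_rfl (hμ.lintegral_Iic_rpow_neg_half_le ht0))
      (by
        filter_upwards [hne, hμ.ae_pos] with s hs hs0
        have : ∀ᵐ t ∂μ, (Iic t).indicator (fun _ => (μ (Iic t))⁻¹) s *
            (μ (Iic t) ^ (-(1 / (2 * p)))) ^ r =
            (Ici s).indicator (fun t => μ (Iic t) ^ (-1 - e)) t := by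
          filter_upwards [hne] with t ht
          rw [← ENNReal.rpow_mul, show -(1 / (2 * p)) * r = -e by rw [he]; ring]
          by_cases hst : s ≤ t
          · rw [indicator_of_mem (show s ∈ Iic t from hst),
              indicator_of_mem (show t ∈ Ici s from hst), sub_eq_add_neg,
              ENNReal.rpow_add _ _ ht.1 ht.2, ENNReal.rpow_neg_one]
          · rw [indicator_of_notMem (show s ∉ Iic t from hst),
              indicator_of_notMem (show t ∉ Ici s from hst), zero_mul]
        rw [lintegral_congr_ae this, lintegral_indicator measurableSet_Ici, ← ENNReal.rpow_mul,
          show -(1 / (2 * p)) * r = -e by rw [he]; ring]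
        exact hμ.lintegral_Ici_rpow_neg_le hs0 he0)
      hg
    refine ⟨(2 ^ (r / p) * ENNReal.ofReal (1 / e)) ^ (1 / r),
      ENNReal.rpow_ne_top_of_nonneg (by positivity) (ENNReal.mul_ne_top
        (ENNReal.rpow_ne_top_of_nonneg (by positivity) (by simp)) ENNReal.ofReal_ne_top),
      fun g hg => ?_⟩
    rw [eLpNorm_eq_lintegral_rpow_enorm_toReal (by positivity) hq',
      eLpNorm_eq_lintegral_rpow_enorm_toReal (by positivity) hq',
      ← ENNReal.mul_rpow_of_nonneg _ _ (by positivity)]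
    refine ENNReal.rpow_le_rpow ?_ (by positivity)
    simp only [enorm_eq_self]
    refine le_trans (le_of_eq ?_) (hS g hg)
    refine lintegral_congr_ae ?_
    filter_upwards [hne] with t ht
    congr 1
    rw [← lintegral_const_mul'' _ hg.restrict, ← lintegral_indicator measurableSet_Iic]
    refine lintegral_congr fun s => ?_
    by_cases hs : s ∈ Iic t <;> simp [indicator_of_mem, indicator_of_notMem, hs]

/-- Averages over `{t : Φ(s) ≤ Φ(t) ≤ 8 Φ(s)}`, where `Φ` is the distribution function, are bounded
in `L_q`. -/
theorem eLpNorm_forward_average_le [NullSingletonClass μ] [SFinite μ] (hμ : IsHalfLineMeasure μ)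
    {q : ℝ≥0∞} (hq : 1 < q) {g : ℝ → ℝ≥0∞} (hg : AEMeasurable g μ) :
    eLpNorm (fun s => (μ (Iic s))⁻¹ *
      ∫⁻ t in {t | μ (Iic s) ≤ μ (Iic t) ∧ μ (Iic t) ≤ 8 * μ (Iic s)}, g t ∂μ) q μ ≤
      8 * eLpNorm g q μ := by
  have hmI := measurable_Iic μ
  have hSm : MeasurableSet {z : ℝ × ℝ | μ (Iic z.1) ≤ μ (Iic z.2) ∧
      μ (Iic z.2) ≤ 8 * μ (Iic z.1)} :=
    (measurableSet_le (hmI.comp measurable_fst) (hmI.comp measurable_snd)).inter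
      (measurableSet_le (hmI.comp measurable_snd) ((hmI.comp measurable_fst).const_mul 8))
  -- Since Φ carries μ to Lebesgue measure, a sublevel set of Φ has mass equal to the level.
  have hle : ∀ y : ℝ≥0∞, y ≠ ∞ → μ {t | μ (Iic t) ≤ y} ≤ y := fun y hy => by
    have : {t | μ (Iic t) ≤ y} = {t | μ.real (Iic t) ≤ y.toReal} := by
      ext t
      rw [mem_ofPred_eq, mem_ofPred_eq, Measure.real,
        ENNReal.toReal_le_toReal (hμ.lt_top t).ne hy]
    rw [this, hμ.measure_real_Iic_le, ENNReal.ofReal_toReal hy]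
  have hk : Measurable (Function.uncurry fun s t : ℝ =>
      ({t | μ (Iic s) ≤ μ (Iic t) ∧ μ (Iic t) ≤ 8 * μ (Iic s)} : Set ℝ).indicator
        (fun _ => (μ (Iic s))⁻¹) t) := by
    have : (Function.uncurry fun s t : ℝ =>
      ({t | μ (Iic s) ≤ μ (Iic t) ∧ μ (Iic t) ≤ 8 * μ (Iic s)} : Set ℝ).indicator
        (fun _ => (μ (Iic s))⁻¹) t) = {z : ℝ × ℝ | μ (Iic z.1) ≤ μ (Iic z.2) ∧
          μ (Iic z.2) ≤ 8 * μ (Iic z.1)}.indicator fun z => (μ (Iic z.1))⁻¹ := by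
      ext ⟨s, t⟩
      simp [indicator]
    rw [this]
    exact (hmI.inv.comp measurable_fst).indicator hSm
  have hSs : ∀ s, MeasurableSet {t | μ (Iic s) ≤ μ (Iic t) ∧ μ (Iic t) ≤ 8 * μ (Iic s)} :=
    fun s => measurable_prodMk_left hSm
  -- Both marginals are at most 8. For fixed s the set has mass at most 8Φ(s), against the factor
  -- 1/Φ(s); for fixed t the kernel is at most 8/Φ(t), on a set of mass at most Φ(t).
  have := eLpNorm_kernel_le (μ := μ) hq hk (C := 8)
    (by
      filter_upwards [hμ.ae_pos] with s hs
      rw [lintegral_indicator (hSs s), setLIntegral_const]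
      calc (μ (Iic s))⁻¹ * μ _ ≤ (μ (Iic s))⁻¹ * μ {t | μ (Iic t) ≤ 8 * μ (Iic s)} := by
            refine mul_le_mul' le_rfl (measure_mono ?_)
            exact fun t ht => ht.2
        _ ≤ (μ (Iic s))⁻¹ * (8 * μ (Iic s)) := by
            gcongr
            exact hle _ (ENNReal.mul_ne_top (by simp) (hμ.lt_top s).ne)
        _ = 8 := by
            rw [mul_left_comm, ENNReal.inv_mul_cancel (hμ.pos s hs).ne' (hμ.lt_top s).ne, mul_one])
    (by
      filter_upwards [hμ.ae_pos] with t ht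
      have ht0 := (hμ.pos t ht).ne'
      have htt := (hμ.lt_top t).ne
      calc _ ≤ ∫⁻ s, ({s | μ (Iic s) ≤ μ (Iic t)} : Set ℝ).indicator
              (fun _ => 8 * (μ (Iic t))⁻¹) s ∂μ := by
            refine lintegral_mono fun s => ?_
            by_cases hst : μ (Iic s) ≤ μ (Iic t) ∧ μ (Iic t) ≤ 8 * μ (Iic s)
            · rw [indicator_of_mem (show t ∈ _ from hst), indicator_of_mem (show s ∈ _ from hst.1)]
              calc (μ (Iic s))⁻¹ = 8 * (8 * μ (Iic s))⁻¹ := by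
                    rw [ENNReal.mul_inv (by simp) (by simp), ← mul_assoc,
                      ENNReal.mul_inv_cancel (by simp) (by simp), one_mul]
                _ ≤ 8 * (μ (Iic t))⁻¹ := mul_le_mul' le_rfl (ENNReal.inv_le_inv.2 hst.2)
            · rw [indicator_of_notMem (show t ∉ _ from hst)]
              exact zero_le
        _ = 8 * (μ (Iic t))⁻¹ * μ {s | μ (Iic s) ≤ μ (Iic t)} := by
            rw [lintegral_indicator (measurableSet_le hmI measurable_const), setLIntegral_const]
        _ ≤ 8 * (μ (Iic t))⁻¹ * μ (Iic t) := mul_le_mul' le_rfl (hle _ htt)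
        _ = 8 := by
            rw [mul_assoc, ENNReal.inv_mul_cancel ht0 htt, mul_one])
    hg
  refine le_trans (le_of_eq ?_) this
  congr 1
  ext s
  rw [← lintegral_const_mul'' _ hg.restrict, ← lintegral_indicator (hSs s)]
  refine lintegral_congr fun t => ?_
  by_cases hst : μ (Iic s) ≤ μ (Iic t) ∧ μ (Iic t) ≤ 8 * μ (Iic s)
  · rw [indicator_of_mem (show t ∈ _ from hst), indicator_of_mem (show t ∈ _ from hst)]
  · rw [indicator_of_notMem (show t ∉ _ from hst), indicator_of_notMem (show t ∉ _ from hst),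
      zero_mul]

end IsHalfLineMeasure

/-! ### Hardy-type estimates that use slow variation -/

section SlowlyVaryingMeasure

variable {A : ℝ → ℝ} {p : ℝ}

/-- The piece (t/2,t] alone suffices: A^(-p) is there at least a constant times its value at t, and
dt/t gives it mass at least 1/2. -/
theorem SlowlyVarying.exists_rpow_neg_le_measure (hA : SlowlyVarying A) (hp : 0 < p) :
    ∃ C : ℝ≥0∞, C ≠ ∞ ∧ ∀ t, 0 < t →
      ENNReal.ofReal (A t ^ (-p)) ≤ C * weightMeasure A p (Iic t) := by
  obtain ⟨C, hC, h⟩ := hA.exists_rpow_neg_le hp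
  refine ⟨ENNReal.ofReal (4 * C), ENNReal.ofReal_ne_top, fun t ht => ?_⟩
  have hAt : 0 < A t ^ (-p) := Real.rpow_pos_of_pos (hA.pos t ht) _
  have h1 : ENNReal.ofReal (A t ^ (-p) / (4 * C)) ≤ weightMeasure A p (Iic t) := by
    rw [weightMeasure_apply hA.measurable measurableSet_Iic]
    calc ENNReal.ofReal (A t ^ (-p) / (4 * C))
        = ∫⁻ _ in Ioc (t / 2) t, ENNReal.ofReal (t⁻¹ * (A t ^ (-p) / (2 * C))) := by
          rw [setLIntegral_const, Real.volume_Ioc, ← ENNReal.ofReal_mul (by positivity)]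
          congr 1
          field_simp
          ring
      _ ≤ ∫⁻ s in Ioc (t / 2) t, ENNReal.ofReal (s⁻¹ * A s ^ (-p)) := by
          refine setLIntegral_mono' measurableSet_Ioc fun s hs => ENNReal.ofReal_le_ofReal ?_
          have hs0 : 0 < s := by linarith [hs.1]
          have hAs : 0 < A s ^ (-p) := Real.rpow_pos_of_pos (hA.pos s hs0) _
          have h2 := h s t hs0 hs.2
          -- The crude bound t/s ≤ 4 is used because its square root is exactly 2. This yields the
          -- 2C; the length t/2 supplies the other factor 2 in 4C.
          have h3 : (t / s) ^ (1 / 2 : ℝ) ≤ 2 := by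
            have h4 : t / s ≤ 4 := by rw [div_le_iff₀ hs0]; linarith [hs.1]
            calc (t / s) ^ (1 / 2 : ℝ) ≤ 4 ^ (1 / 2 : ℝ) := by gcongr
              _ = 2 := by
                rw [show (4 : ℝ) = 2 ^ (2 : ℝ) by norm_num, ← Real.rpow_mul (by norm_num)]
                norm_num
          have h5 : A t ^ (-p) / (2 * C) ≤ A s ^ (-p) := by
            rw [div_le_iff₀ (by positivity)]
            calc A t ^ (-p) ≤ C * (t / s) ^ (1 / 2 : ℝ) * A s ^ (-p) := h2
              _ ≤ C * 2 * A s ^ (-p) := by gcongr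
              _ = _ := by ring
          have h6 : t⁻¹ ≤ s⁻¹ := inv_anti₀ hs0 hs.2
          gcongr
      _ ≤ _ := by
          refine lintegral_mono_set fun s hs => mem_inter hs.2 (mem_Ioi.2 ?_)
          linarith [hs.1]
  calc ENNReal.ofReal (A t ^ (-p))
      = ENNReal.ofReal (4 * C) * ENNReal.ofReal (A t ^ (-p) / (4 * C)) := by
        rw [← ENNReal.ofReal_mul (by positivity)]
        congr 1
        field_simp
    _ ≤ _ := by gcongr

/-- The integrand is s^(-2) A(s)^(-p). Replacing A(s) by A(t) costs (s/t)^(1/2), and s^(-3/2) is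
still integrable at infinity. -/
theorem SlowlyVarying.exists_lintegral_Ici_inv_le (hA : SlowlyVarying A) (hp : 0 < p) :
    ∃ C : ℝ, 0 < C ∧ ∀ t, 0 < t →
      ∫⁻ s in Ici t, ENNReal.ofReal s⁻¹ ∂weightMeasure A p ≤
        ENNReal.ofReal (C * t⁻¹ * A t ^ (-p)) := by
  obtain ⟨C, hC, h⟩ := hA.exists_rpow_neg_le hp
  refine ⟨2 * C, by positivity, fun t ht => ?_⟩
  have hAt : 0 < A t ^ (-p) := Real.rpow_pos_of_pos (hA.pos t ht) _
  rw [setLIntegral_weightMeasure hA.measurable _ measurableSet_Ici,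
    inter_eq_left.2 (Ici_subset_Ioi.2 ht)]
  have hm : Measurable fun s : ℝ => ENNReal.ofReal (s ^ (-1 - 1 / 2 : ℝ)) :=
    (measurable_id.pow_const _).ennreal_ofReal
  calc ∫⁻ s in Ici t, ENNReal.ofReal (s⁻¹ * A s ^ (-p)) * ENNReal.ofReal s⁻¹
      ≤ ∫⁻ s in Ici t, ENNReal.ofReal (C * t ^ (-(1 / 2) : ℝ) * A t ^ (-p)) *
          ENNReal.ofReal (s ^ (-1 - 1 / 2 : ℝ)) := by
        refine setLIntegral_mono' measurableSet_Ici fun s hs => ?_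
        have hs0 : 0 < s := ht.trans_le hs
        have hAs : 0 < A s ^ (-p) := Real.rpow_pos_of_pos (hA.pos s hs0) _
        rw [← ENNReal.ofReal_mul (by positivity), ← ENNReal.ofReal_mul (by positivity)]
        refine ENNReal.ofReal_le_ofReal ?_
        have e1 : s ^ (-1 - 1 / 2 : ℝ) = s⁻¹ * s⁻¹ * s ^ (1 / 2 : ℝ) := by
          rw [← Real.rpow_neg_one s, ← Real.rpow_add hs0, ← Real.rpow_add hs0]
          norm_num
        calc s⁻¹ * A s ^ (-p) * s⁻¹ ≤ s⁻¹ * (C * (s / t) ^ (1 / 2 : ℝ) * A t ^ (-p)) * s⁻¹ := by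
              gcongr
              exact h t s ht hs
          _ = _ := by
              rw [e1, Real.div_rpow hs0.le ht.le, Real.rpow_neg ht.le]
              ring
    _ = ENNReal.ofReal (2 * C * t⁻¹ * A t ^ (-p)) := by
        rw [lintegral_const_mul _ hm, lintegral_Ici_rpow_neg ht (by norm_num),
          ← ENNReal.ofReal_mul (by positivity)]
        congr 1
        have e2 : t⁻¹ = t ^ (-(1 / 2) : ℝ) * t ^ (-(1 / 2) : ℝ) := by
          rw [← Real.rpow_neg_one t, ← Real.rpow_add ht]
          norm_num
        rw [e2]
        ring

/-- The adjoint Hardy inequality for a slowly varying weight. -/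
theorem SlowlyVarying.exists_eLpNorm_tail_le (hA : SlowlyVarying A) (hp : 0 < p)
    (hμ : IsHalfLineMeasure (weightMeasure A p)) {q : ℝ≥0∞} (hq : 1 < q) :
    ∃ C : ℝ≥0∞, C ≠ ∞ ∧ ∀ g : ℝ → ℝ≥0∞, AEMeasurable g (weightMeasure A p) →
      eLpNorm (fun t => (weightMeasure A p (Iic t))⁻¹ * (ENNReal.ofReal t *
        ∫⁻ s in Ici t, ENNReal.ofReal s⁻¹ * g s ∂weightMeasure A p)) q (weightMeasure A p) ≤
        C * eLpNorm g q (weightMeasure A p) := by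
  obtain ⟨C₁, hC₁, h₁⟩ := hA.exists_rpow_neg_le_measure hp
  obtain ⟨C₂, hC₂, h₂⟩ := hA.exists_lintegral_Ici_inv_le hp
  set μ := weightMeasure A p with hμdef
  have hmI := IsHalfLineMeasure.measurable_Iic μ
  set φ : ℝ → ℝ≥0∞ := fun t => (μ (Iic t))⁻¹ * ENNReal.ofReal t with hφ
  have hφm : Measurable φ := hmI.inv.mul ENNReal.measurable_ofReal
  have hk : Measurable (Function.uncurry fun t s : ℝ =>
      (Ici t).indicator (fun s => φ t * ENNReal.ofReal s⁻¹) s) := by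
    have : (Function.uncurry fun t s : ℝ =>
        (Ici t).indicator (fun s => φ t * ENNReal.ofReal s⁻¹) s) =
        {z : ℝ × ℝ | z.1 ≤ z.2}.indicator fun z => φ z.1 * ENNReal.ofReal z.2⁻¹ := by
      ext ⟨t, s⟩
      by_cases h : t ≤ s <;> simp [indicator, h]
    rw [this]
    exact ((hφm.comp measurable_fst).mul
      (measurable_snd.inv.ennreal_ofReal)).indicator
        (measurableSet_le measurable_fst measurable_snd)
  have hcancel : ∀ t, 0 < t → (μ (Iic t))⁻¹ * μ (Iic t) = 1 := fun t ht =>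
    ENNReal.inv_mul_cancel (hμ.pos t ht).ne' (hμ.lt_top t).ne
  -- Integration in s: the tail is at most C₂ t⁻¹ A(t)^(-p), the factor t cancels, and
  -- A(t)^(-p)/Φ(t) ≤ C₁. The constant (C₂ + 1)C₁ is chosen to dominate both marginals.
  have b₁ : ∀ᵐ t ∂μ, ∫⁻ s, (Ici t).indicator (fun s => φ t * ENNReal.ofReal s⁻¹) s ∂μ ≤
      (ENNReal.ofReal C₂ + 1) * C₁ := by
    filter_upwards [hμ.ae_pos] with t ht
    rw [lintegral_indicator measurableSet_Ici,
      lintegral_const_mul _ measurable_inv.ennreal_ofReal]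
    calc φ t * ∫⁻ s in Ici t, ENNReal.ofReal s⁻¹ ∂μ
        ≤ φ t * ENNReal.ofReal (C₂ * t⁻¹ * A t ^ (-p)) := by gcongr; exact h₂ t ht
      _ = (μ (Iic t))⁻¹ * (ENNReal.ofReal C₂ * ENNReal.ofReal (A t ^ (-p))) := by
          have := Real.rpow_pos_of_pos (hA.pos t ht) (-p)
          rw [hφ, mul_assoc, ← ENNReal.ofReal_mul ht.le, ← ENNReal.ofReal_mul hC₂.le]
          congr 2
          field_simp
      _ ≤ (μ (Iic t))⁻¹ * (ENNReal.ofReal C₂ * (C₁ * μ (Iic t))) := by gcongr; exact h₁ t ht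
      _ = ENNReal.ofReal C₂ * C₁ * ((μ (Iic t))⁻¹ * μ (Iic t)) := by ring
      _ ≤ _ := by rw [hcancel t ht, mul_one]; gcongr; exact le_self_add
  -- Integration in t: the density t⁻¹ A^(-p) times t/Φ(t) is at most C₁, so the integral over (0,s]
  -- is at most C₁ s, which s⁻¹ compensates.
  have b₂ : ∀ᵐ s ∂μ, ∫⁻ t, (Ici t).indicator (fun s => φ t * ENNReal.ofReal s⁻¹) s ∂μ ≤
      (ENNReal.ofReal C₂ + 1) * C₁ := by
    filter_upwards [hμ.ae_pos] with s hs
    have : ∀ t, (Ici t).indicator (fun s => φ t * ENNReal.ofReal s⁻¹) s =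
        (Iic s).indicator (fun t => φ t * ENNReal.ofReal s⁻¹) t := by
      intro t
      simp [indicator]
    simp only [this]
    rw [lintegral_indicator measurableSet_Iic, lintegral_mul_const _ hφm,
      setLIntegral_weightMeasure hA.measurable _ measurableSet_Iic, inter_comm, Ioi_inter_Iic]
    calc (∫⁻ t in Ioc 0 s, ENNReal.ofReal (t⁻¹ * A t ^ (-p)) * φ t) * ENNReal.ofReal s⁻¹
        ≤ (∫⁻ _ in Ioc 0 s, C₁) * ENNReal.ofReal s⁻¹ := by
          refine mul_le_mul' (setLIntegral_mono' measurableSet_Ioc fun t ht => ?_) le_rfl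
          have := Real.rpow_pos_of_pos (hA.pos t ht.1) (-p)
          have ht0 := ht.1
          calc ENNReal.ofReal (t⁻¹ * A t ^ (-p)) * φ t
              = ENNReal.ofReal (A t ^ (-p)) * (μ (Iic t))⁻¹ := by
                rw [hφ]
                dsimp only
                rw [mul_left_comm, mul_comm, ← ENNReal.ofReal_mul (by positivity)]
                congr 2
                field_simp
            _ ≤ C₁ * μ (Iic t) * (μ (Iic t))⁻¹ := by gcongr; exact h₁ t ht0
            _ = C₁ := by rw [mul_assoc, mul_comm (μ _), hcancel t ht0, mul_one]
      _ = C₁ := by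
          rw [setLIntegral_const, Real.volume_Ioc, mul_assoc, ← ENNReal.ofReal_mul (by linarith)]
          simp [hs.ne']
      _ ≤ _ := le_mul_of_one_le_left zero_le le_add_self
  refine ⟨(ENNReal.ofReal C₂ + 1) * C₁, ENNReal.mul_ne_top (by simp) hC₁, fun g hg => ?_⟩
  refine le_trans (le_of_eq ?_) (eLpNorm_kernel_le hq hk b₁ b₂ hg)
  congr 1
  ext t
  have hm : AEMeasurable (fun s => ENNReal.ofReal s⁻¹ * g s) (μ.restrict (Ici t)) :=
    measurable_inv.ennreal_ofReal.aemeasurable.mul hg.restrict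
  rw [← mul_assoc, ← lintegral_const_mul'' _ hm, ← lintegral_indicator measurableSet_Ici]
  refine lintegral_congr fun s => ?_
  by_cases hs : s ∈ Ici t
  · rw [indicator_of_mem hs, indicator_of_mem hs]
    simp only [hφ, mul_assoc]
  · rw [indicator_of_notMem hs, indicator_of_notMem hs, zero_mul]

end SlowlyVaryingMeasure

/-! ### K- and J-functionals and integrals in the sum space -/

namespace CompatibleCouple

variable {𝕜 X₀ X₁ E : Type*} [RCLike 𝕜]
  [NormedAddCommGroup X₀] [NormedSpace 𝕜 X₀] [NormedAddCommGroup X₁] [NormedSpace 𝕜 X₁]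
  [AddCommGroup E] [Module 𝕜 E] [TopologicalSpace E]

theorem monotone_K (C : CompatibleCouple 𝕜 X₀ X₁ E) (f : E) : Monotone (C.K f) := by
  intro s t hst
  refine iInf₂_mono fun p _ => ENNReal.ofReal_le_ofReal ?_
  gcongr

theorem measurable_K (C : CompatibleCouple 𝕜 X₀ X₁ E) (f : E) : Measurable (C.K f) :=
  (C.monotone_K f).measurable

theorem J_nonneg (C : CompatibleCouple 𝕜 X₀ X₁ E) (f : C.Inter) (t : ℝ) : 0 ≤ C.J f t :=
  (norm_nonneg _).trans (le_max_left _ _)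

theorem aemeasurable_J (C : CompatibleCouple 𝕜 X₀ X₁ E) {u : ℝ → C.Inter} {μ : Measure ℝ}
    (hu : AEStronglyMeasurable u μ) : AEMeasurable (fun t => C.J (u t) t) μ := by
  have h0 : AEStronglyMeasurable (fun t => (u t).1.1) μ :=
    (continuous_fst.comp continuous_subtype_val).comp_aestronglyMeasurable hu
  have h1 : AEStronglyMeasurable (fun t => (u t).1.2) μ :=
    (continuous_snd.comp continuous_subtype_val).comp_aestronglyMeasurable hu
  exact h0.norm.aemeasurable.max (aemeasurable_id.mul h1.norm.aemeasurable)

section Sum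

variable [IsTopologicalAddGroup E] [T2Space E]

instance (C : CompatibleCouple 𝕜 X₀ X₁ E) : IsScalarTower ℝ 𝕜 C.Sum :=
  IsScalarTower.of_algebraMap_smul fun _ _ => rfl

/-- The inclusion of `X₀` in `X₀ + X₁`. -/
noncomputable def leftToSum (C : CompatibleCouple 𝕜 X₀ X₁ E) : X₀ →L[𝕜] C.Sum :=
  LinearMap.mkContinuous ((LinearMap.ker C.addMap).mkQ ∘ₗ
    (WithLp.linearEquiv 1 𝕜 (X₀ × X₁)).symm.toLinearMap ∘ₗ LinearMap.inl 𝕜 X₀ X₁) 1 fun x => by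
      refine (Submodule.Quotient.norm_mk_le _ _).trans (le_of_eq ?_)
      rw [WithLp.prod_norm_eq_of_L1]
      simp

/-- The inclusion of `X₁` in `X₀ + X₁`. -/
noncomputable def rightToSum (C : CompatibleCouple 𝕜 X₀ X₁ E) : X₁ →L[𝕜] C.Sum :=
  LinearMap.mkContinuous ((LinearMap.ker C.addMap).mkQ ∘ₗ
    (WithLp.linearEquiv 1 𝕜 (X₀ × X₁)).symm.toLinearMap ∘ₗ LinearMap.inr 𝕜 X₀ X₁) 1 fun x => by
      refine (Submodule.Quotient.norm_mk_le _ _).trans (le_of_eq ?_)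
      rw [WithLp.prod_norm_eq_of_L1]
      simp

theorem sumι_leftToSum (C : CompatibleCouple 𝕜 X₀ X₁ E) (x : X₀) :
    C.sumι (C.leftToSum x) = C.ι₀ x := by
  change C.ι₀ x + C.ι₁ 0 = C.ι₀ x
  simp

theorem sumι_rightToSum (C : CompatibleCouple 𝕜 X₀ X₁ E) (x : X₁) :
    C.sumι (C.rightToSum x) = C.ι₁ x := by
  change C.ι₀ 0 + C.ι₁ x = C.ι₁ x
  simp

theorem sumι_injective (C : CompatibleCouple 𝕜 X₀ X₁ E) : Function.Injective C.sumι :=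
  LinearMap.ker_eq_bot.1 (Submodule.ker_liftQ_eq_bot _ _ _ le_rfl)

theorem interToSum_eq_left (C : CompatibleCouple 𝕜 X₀ X₁ E) (x : C.Inter) :
    C.interToSum x = C.leftToSum x.1.1 := rfl

theorem interToSum_eq_right (C : CompatibleCouple 𝕜 X₀ X₁ E) (x : C.Inter) :
    C.interToSum x = C.rightToSum x.1.2 := by
  refine C.sumι_injective ?_
  rw [interToSum_eq_left, sumι_leftToSum, sumι_rightToSum]
  exact x.2

theorem exists_sumι_eq (C : CompatibleCouple 𝕜 X₀ X₁ E) (s : C.Sum) :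
    ∃ x₀ x₁, C.sumι s = C.ι₀ x₀ + C.ι₁ x₁ := by
  obtain ⟨z, rfl⟩ := (LinearMap.ker C.addMap).mkQ_surjective s
  exact ⟨z.fst, z.snd, rfl⟩

variable [NormedSpace ℝ X₀] [IsScalarTower ℝ 𝕜 X₀]

/-- If `u` is integrable in `X₀` for `ds/s`, then `∫ u ds/s` can be computed in `X₀`. -/
theorem isRepresentation_iff [CompleteSpace X₀] [CompleteSpace X₁]
    (C : CompatibleCouple 𝕜 X₀ X₁ E) {f : E} {u : ℝ → C.Inter}
    (hu : AEStronglyMeasurable u (volume.restrict (Ioi 0)))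
    (hi : IntegrableOn (fun s : ℝ => s⁻¹ • (u s).1.1) (Ioi 0)) :
    C.IsRepresentation f u ↔ f = C.ι₀ (∫ s in Ioi (0 : ℝ), s⁻¹ • (u s).1.1) := by
  have e : (fun s : ℝ => s⁻¹ • C.interToSum (u s)) =
      fun s => (C.leftToSum.restrictScalars ℝ) (s⁻¹ • (u s).1.1) := by
    ext s
    rw [map_smul]
    rfl
  have h : ∫ s in Ioi (0 : ℝ), s⁻¹ • C.interToSum (u s) =
      C.leftToSum (∫ s in Ioi (0 : ℝ), s⁻¹ • (u s).1.1) := by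
    rw [e, ContinuousLinearMap.integral_comp_comm _ hi]
    rfl
  rw [← sumι_leftToSum, ← h]
  exact ⟨fun H => H.eq_integral, fun H => ⟨hu, by
    rw [e]; exact (C.leftToSum.restrictScalars ℝ).integrable_comp hi, H⟩⟩

variable [NormedSpace ℝ X₁] [IsScalarTower ℝ 𝕜 X₁]

/-- Cut the representing integral at t: the part over (0,t] converges in X₀ because the X₀-norm is
at most J, and the part over (t,∞) converges in X₁ because the X₁-norm is at most J/s. -/
theorem K_le_lintegral_J [CompleteSpace X₀] [CompleteSpace X₁]
    (C : CompatibleCouple 𝕜 X₀ X₁ E) {f : E} {u : ℝ → C.Inter} (hu : C.IsRepresentation f u)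
    {t : ℝ} (ht : 0 < t) :
    C.K f t ≤ (∫⁻ s in Ioc 0 t, ENNReal.ofReal s⁻¹ * ENNReal.ofReal (C.J (u s) s)) +
      ENNReal.ofReal t * ∫⁻ s in Ioi t,
        ENNReal.ofReal s⁻¹ * (ENNReal.ofReal s⁻¹ * ENNReal.ofReal (C.J (u s) s)) := by
  set a := ∫⁻ s in Ioc 0 t, ENNReal.ofReal s⁻¹ * ENNReal.ofReal (C.J (u s) s) with ha
  set b := ∫⁻ s in Ioi t,
        ENNReal.ofReal s⁻¹ * (ENNReal.ofReal s⁻¹ * ENNReal.ofReal (C.J (u s) s)) with hb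
  -- If either integral is infinite there is nothing to prove; otherwise both pieces are Bochner
  -- integrable in their own spaces.
  rcases eq_or_ne a ∞ with ha' | ha'
  · simp [ha']
  rcases eq_or_ne b ∞ with hb' | hb'
  · rw [hb', ENNReal.mul_top (by simpa using ht)]
    simp
  have hm := hu.aestronglyMeasurable
  have hm0 : AEStronglyMeasurable (fun s : ℝ => s⁻¹ • (u s).1.1) (volume.restrict (Ioi 0)) :=
    measurable_inv.aestronglyMeasurable.smul
      ((continuous_fst.comp continuous_subtype_val).comp_aestronglyMeasurable hm)
  have hm1 : AEStronglyMeasurable (fun s : ℝ => s⁻¹ • (u s).1.2) (volume.restrict (Ioi 0)) :=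
    measurable_inv.aestronglyMeasurable.smul
      ((continuous_snd.comp continuous_subtype_val).comp_aestronglyMeasurable hm)
  have n0 : ∫⁻ s in Ioc 0 t, ‖s⁻¹ • (u s).1.1‖ₑ ≤ a := by
    refine setLIntegral_mono' measurableSet_Ioc fun s hs => ?_
    rw [enorm_smul, Real.enorm_of_nonneg (inv_nonneg.2 hs.1.le), ← ofReal_norm (u s).1.1]
    gcongr
    exact le_max_left _ _
  have n1 : ∫⁻ s in Ioi t, ‖s⁻¹ • (u s).1.2‖ₑ ≤ b := by
    refine setLIntegral_mono' measurableSet_Ioi fun s hs => ?_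
    have hs0 : 0 < s := ht.trans hs
    rw [enorm_smul, Real.enorm_of_nonneg (inv_nonneg.2 hs0.le), ← ofReal_norm (u s).1.2,
      ← ENNReal.ofReal_mul (p := s⁻¹) (q := C.J _ _) (by positivity)]
    gcongr
    rw [← div_eq_inv_mul, le_div_iff₀ hs0, mul_comm]
    exact le_max_right _ _
  have i0 : IntegrableOn (fun s : ℝ => s⁻¹ • (u s).1.1) (Ioc 0 t) :=
    ⟨hm0.mono_measure (Measure.restrict_mono Ioc_subset_Ioi_self le_rfl),
      n0.trans_lt ha'.lt_top⟩
  have i1 : IntegrableOn (fun s : ℝ => s⁻¹ • (u s).1.2) (Ioi t) :=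
    ⟨hm1.mono_measure (Measure.restrict_mono (Ioi_subset_Ioi ht.le) le_rfl),
      n1.trans_lt hb'.lt_top⟩
  -- The integrals in X₀ and X₁ are mapped by the continuous inclusions to the integrals in X₀ + X₁.
  have hf : f = C.ι₀ (∫ s in Ioc 0 t, s⁻¹ • (u s).1.1) + C.ι₁ (∫ s in Ioi t, s⁻¹ • (u s).1.2) := by
    have e0 : ∫ s in Ioc 0 t, s⁻¹ • C.interToSum (u s) =
        C.leftToSum (∫ s in Ioc 0 t, s⁻¹ • (u s).1.1) := by
      rw [← ContinuousLinearMap.coe_restrictScalars' (R := ℝ),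
        ← ContinuousLinearMap.integral_comp_comm _ i0]
      simp only [map_smul]
      rfl
    have e1 : ∫ s in Ioi t, s⁻¹ • C.interToSum (u s) =
        C.rightToSum (∫ s in Ioi t, s⁻¹ • (u s).1.2) := by
      rw [← ContinuousLinearMap.coe_restrictScalars' (R := ℝ),
        ← ContinuousLinearMap.integral_comp_comm _ i1]
      simp only [map_smul, interToSum_eq_right]
      rfl
    rw [hu.eq_integral, ← Ioc_union_Ioi_eq_Ioi ht.le,
      setIntegral_union (Ioc_disjoint_Ioi le_rfl) measurableSet_Ioi
        (hu.integrable.mono_set Ioc_subset_Ioi_self)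
        (hu.integrable.mono_set (Ioi_subset_Ioi ht.le)), e0, e1, map_add, sumι_leftToSum,
      sumι_rightToSum]
  refine (iInf₂_le (_, _) hf).trans ?_
  rw [ENNReal.ofReal_add (by positivity) (by positivity), ENNReal.ofReal_mul ht.le, ofReal_norm,
    ofReal_norm]
  gcongr
  · exact (enorm_integral_le_lintegral_enorm _).trans n0
  · exact (enorm_integral_le_lintegral_enorm _).trans n1

end Sum

end CompatibleCouple

/-! ### The J-norm controls the K-norm -/

namespace CompatibleCouple

variable {𝕜 X₀ X₁ E : Type*} [RCLike 𝕜]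
  [NormedAddCommGroup X₀] [NormedSpace 𝕜 X₀] [NormedAddCommGroup X₁] [NormedSpace 𝕜 X₁]
  [AddCommGroup E] [Module 𝕜 E] [TopologicalSpace E]

theorem eLpNorm_mul_J (C : CompatibleCouple 𝕜 X₀ X₁ E) {q : ℝ≥0∞} {v : ℝ → ℝ}
    (hv : ∀ t, 0 < t → 0 < v t) (u : ℝ → C.Inter) :
    eLpNorm (fun t : ℝ => t ^ (-0 - (1 / q).toReal) * v t * C.J (u t) t) q
      (volume.restrict (Ioi 0)) =
    eLpNorm (fun t : ℝ => ENNReal.ofReal (t ^ (-0 - (1 / q).toReal) * v t) *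
      ENNReal.ofReal (C.J (u t) t)) q (volume.restrict (Ioi 0)) := by
  refine eLpNorm_congr_enorm_ae ?_
  filter_upwards [ae_restrict_mem measurableSet_Ioi] with t ht
  have ht : 0 < t := ht
  have := hv t ht
  rw [Real.enorm_of_nonneg (mul_nonneg (by positivity) (C.J_nonneg _ _)), enorm_eq_self,
    ENNReal.ofReal_mul (by positivity)]

/-- The `K`-norm with weight `B` as a norm with respect to the measure `t⁻¹ A(t)^(-p) dt`. -/
theorem kNorm_eq_eLpNorm (C : CompatibleCouple 𝕜 X₀ X₁ E) {q : ℝ≥0∞} (hq : q ≠ 0) {p : ℝ}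
    {A B : ℝ → ℝ} (hA : SlowlyVarying A) (hμ : IsHalfLineMeasure (weightMeasure A p))
    (hB : ∀ x, 0 < x →
      B x = A x ^ (-(p * (1 / q).toReal)) * ((weightMeasure A p).real (Iic x))⁻¹) (f : E) :
    C.kNorm 0 q B f =
      eLpNorm (fun t => (weightMeasure A p (Iic t))⁻¹ * C.K f t) q (weightMeasure A p) := by
  rw [kNorm, ← eLpNorm_weightMeasure hA.pos hA.measurable hq]
  refine eLpNorm_congr_ae ?_
  filter_upwards [ae_restrict_mem measurableSet_Ioi] with t ht
  have ht : 0 < t := ht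
  have hAt := hA.pos t ht
  have hm := hμ.real_Iic_pos ht
  rw [hB t ht, ← hμ.ofReal_real_Iic, ← ENNReal.ofReal_inv_of_pos hm,
    ← mul_assoc (ENNReal.ofReal _),
    ← ENNReal.ofReal_mul (by positivity)]
  congr 2
  rw [Real.mul_rpow (by positivity) (by positivity), Real.inv_rpow ht.le, ← Real.rpow_mul hAt.le,
    ← Real.rpow_neg ht.le, mul_assoc]
  congr 3
  · ring
  · ring

section Sum

variable [IsTopologicalAddGroup E] [T2Space E]

/-- Dividing by c moves the constant across the infimum. Nonvanishing of c covers the case without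
representations, where the right side must be ∞. -/
theorem le_mul_jNorm (C : CompatibleCouple 𝕜 X₀ X₁ E) {θ : ℝ} {q : ℝ≥0∞} {v : ℝ → ℝ} {f : E}
    {x c : ℝ≥0∞} (hc0 : c ≠ 0) (hc : c ≠ ∞)
    (h : ∀ u, C.IsRepresentation f u → x ≤ c *
      eLpNorm (fun t : ℝ => t ^ (-θ - (1 / q).toReal) * v t * C.J (u t) t) q
        (volume.restrict (Ioi 0))) :
    x ≤ c * C.jNorm θ q v f := by
  rw [← ENNReal.div_le_iff' hc0 hc]
  refine le_iInf₂ fun u hu => ?_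
  rw [ENNReal.div_le_iff' hc0 hc]
  exact h u hu

variable [NormedSpace ℝ X₀] [IsScalarTower ℝ 𝕜 X₀] [NormedSpace ℝ X₁] [IsScalarTower ℝ 𝕜 X₁]
  [CompleteSpace X₀]

/-- For g = A^p J(u), the quotient K(f,t)/Φ(t) is at most the Hardy average of g plus its adjoint
counterpart, both bounded on L_q(μ). -/
theorem exists_kNorm_le_jNorm [CompleteSpace X₁]
    (C : CompatibleCouple 𝕜 X₀ X₁ E) {q : ℝ≥0∞} (hq : 1 < q) {p : ℝ} (hp0 : 0 < p)
    (hp : (1 / q).toReal * p + 1 = p)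
    {A B : ℝ → ℝ} (hA : SlowlyVarying A) (hμ : IsHalfLineMeasure (weightMeasure A p))
    (hB : ∀ x, 0 < x →
      B x = A x ^ (-(p * (1 / q).toReal)) * ((weightMeasure A p).real (Iic x))⁻¹) :
    ∃ c : ℝ≥0∞, c ≠ 0 ∧ c ≠ ∞ ∧ ∀ f, C.kNorm 0 q B f ≤ c * C.jNorm 0 q A f := by
  obtain ⟨c₁, hc₁, h₁⟩ := hμ.exists_eLpNorm_average_le hq
  obtain ⟨c₂, hc₂, h₂⟩ := hA.exists_eLpNorm_tail_le hp0 hμ hq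
  -- The summand 1 only makes the constant nonzero.
  refine ⟨c₁ + c₂ + 1, by simp, by simp [hc₁, hc₂], fun f =>
    C.le_mul_jNorm (by simp) (by simp [hc₁, hc₂]) fun u hu => ?_⟩
  rw [C.eLpNorm_mul_J hA.pos, eLpNorm_rpow_mul_weight hA.pos hA.measurable (by positivity) hp,
    C.kNorm_eq_eLpNorm (by positivity) hA hμ hB]
  set μ := weightMeasure A p with hμdef
  set g : ℝ → ℝ≥0∞ := fun t => ENNReal.ofReal (A t ^ p) * ENNReal.ofReal (C.J (u t) t) with hg
  have hgm : AEMeasurable g μ :=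
    ((hA.measurable.pow_const _).ennreal_ofReal.mul
      (C.aemeasurable_J hu.aestronglyMeasurable).ennreal_ofReal).mono_ac
        weightMeasure_absolutelyContinuous
  have hmI := IsHalfLineMeasure.measurable_Iic μ
  have hm₁ : AEStronglyMeasurable (fun t => (μ (Iic t))⁻¹ * ∫⁻ s in Iic t, g s ∂μ) μ :=
    (hmI.inv.mul (Monotone.measurable fun _ _ h =>
      lintegral_mono_set (Iic_subset_Iic.2 h))).aestronglyMeasurable
  have hm₂ : AEStronglyMeasurable (fun t => (μ (Iic t))⁻¹ * (ENNReal.ofReal t *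
      ∫⁻ s in Ici t, ENNReal.ofReal s⁻¹ * g s ∂μ)) μ :=
    (hmI.inv.mul (ENNReal.measurable_ofReal.mul (Antitone.measurable fun _ _ h =>
      lintegral_mono_set (Ici_subset_Ici.2 h)))).aestronglyMeasurable
  calc eLpNorm (fun t => (μ (Iic t))⁻¹ * C.K f t) q μ
      ≤ eLpNorm ((fun t => (μ (Iic t))⁻¹ * ∫⁻ s in Iic t, g s ∂μ) + fun t => (μ (Iic t))⁻¹ *
          (ENNReal.ofReal t * ∫⁻ s in Ici t, ENNReal.ofReal s⁻¹ * g s ∂μ)) q μ := by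
        refine eLpNorm_mono_enorm_ae ?_
        filter_upwards [hμ.ae_pos] with t ht
        simp only [enorm_eq_self, Pi.add_apply]
        rw [← mul_add]
        gcongr
        refine (C.K_le_lintegral_J hu ht).trans ?_
        gcongr ?_ + _ * ?_
        · rw [← Ioi_inter_Iic, inter_comm, setLIntegral_inv_mul hA.pos hA.measurable _
            measurableSet_Iic]
        · refine (lintegral_mono_set Ioi_subset_Ici_self).trans (le_of_eq ?_)
          have e := setLIntegral_inv_mul (p := p) hA.pos hA.measurable
            (fun s => ENNReal.ofReal s⁻¹ * ENNReal.ofReal (C.J (u s) s)) (measurableSet_Ici (a := t))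
          rw [inter_eq_left.2 (Ici_subset_Ioi.2 ht)] at e
          rw [e]
          simp only [hg, mul_left_comm]
          rfl
    _ ≤ c₁ * eLpNorm g q μ + c₂ * eLpNorm g q μ :=
        (eLpNorm_add_le hm₁ hm₂ hq.le).trans (add_le_add (h₁ g hgm) (h₂ g hgm))
    _ ≤ _ := by
        rw [← add_mul]
        exact mul_le_mul' le_self_add le_rfl

end Sum

end CompatibleCouple

/-! ### The K-norm controls the J-norm: discretization by values of Φ -/

namespace IsHalfLineMeasure

/-- Points `x 0 > x 1 > ⋯` at which the distribution function takes the values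
`2Φ(1), Φ(1), Φ(1)/2, …`. -/
theorem exists_seq {μ : Measure ℝ} [NullSingletonClass μ] (hμ : IsHalfLineMeasure μ) :
    ∃ x : ℕ → ℝ, StrictAnti x ∧ (∀ n, 0 < x n) ∧ 1 ≤ x 1 ∧
      ∀ n, μ (Iic (x n)) = ENNReal.ofReal (μ.real (Iic 1) * 2 * (1 / 2) ^ n) := by
  have h1 : 0 < μ.real (Iic 1) := hμ.real_Iic_pos one_pos
  choose x hx0 hx hS using fun n : ℕ =>
    hμ.exists_real_Iic_eq (y := μ.real (Iic 1) * 2 * (1 / 2) ^ n) (by positivity)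
  refine ⟨x, fun m n hmn => ?_, fun n => ?_, ?_, fun n => ?_⟩
  · refine lt_of_not_ge fun h => ?_
    have h2 := hμ.monotone_real_Iic h
    simp only [hx] at h2
    have h3 : (1 / 2 : ℝ) ^ n < (1 / 2) ^ m :=
      pow_lt_pow_right_of_lt_one₀ (by norm_num) (by norm_num) hmn
    have h4 : μ.real (Iic 1) * 2 * (1 / 2) ^ n < μ.real (Iic 1) * 2 * (1 / 2) ^ m := by gcongr
    linarith
  · refine lt_of_not_ge fun h => ?_
    have h2 := hx n
    rw [hμ.real_Iic_nonpos h] at h2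
    have : 0 < μ.real (Iic 1) * 2 * (1 / 2) ^ n := by positivity
    linarith
  -- The point 1 lies in the sublevel set at level Φ(1), which is `Iic (x 1)`; strict monotonicity
  -- of Φ is not required.
  · have : (1 : ℝ) ∈ {s | μ.real (Iic s) ≤ μ.real (Iic 1) * 2 * (1 / 2) ^ 1} := by
      simp only [mem_ofPred_eq]
      linarith
    rw [hS] at this
    exact this
  · rw [← hx, hμ.ofReal_real_Iic]

end IsHalfLineMeasure

theorem pairwise_disjoint_Ioc_of_antitone {x : ℕ → ℝ} (hx : Antitone x) :
    Pairwise (Function.onFun Disjoint fun n => Ioc (x (n + 1)) (x n)) := by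
  rw [pairwise_disjoint_on]
  intro m n hmn
  rw [Set.disjoint_left]
  intro s hs hs'
  exact absurd (hs'.2.trans (hx (Nat.succ_le_of_lt hmn))) (not_le.2 hs.1)

namespace CompatibleCouple

variable {𝕜 X₀ X₁ E : Type*} [RCLike 𝕜]
  [NormedAddCommGroup X₀] [NormedSpace 𝕜 X₀] [NormedAddCommGroup X₁] [NormedSpace 𝕜 X₁]
  [AddCommGroup E] [Module 𝕜 E] [TopologicalSpace E]

/-- If `X₁` embeds contractively in `X₀`, then `K(x,t) ≥ min(1,t) ‖x‖`. -/
theorem min_mul_norm_le_K (C : CompatibleCouple 𝕜 X₀ X₁ E)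
    (hC : ∀ y, ∃ x, C.ι₀ x = C.ι₁ y ∧ ‖x‖ ≤ ‖y‖) (x : X₀) {t : ℝ} (ht : 0 < t) :
    ENNReal.ofReal (min 1 t * ‖x‖) ≤ C.K (C.ι₀ x) t := by
  refine le_iInf₂ fun p hp => ENNReal.ofReal_le_ofReal ?_
  obtain ⟨y, hy, hyn⟩ := hC p.2
  have hx : x = p.1 + y := C.injective₀ (by rw [hp, map_add, hy])
  calc min 1 t * ‖x‖ ≤ min 1 t * (‖p.1‖ + ‖p.2‖) := by
        rw [hx]
        gcongr
        exact (norm_add_le _ _).trans (by gcongr)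
    _ = min 1 t * ‖p.1‖ + min 1 t * ‖p.2‖ := mul_add _ _ _
    _ ≤ 1 * ‖p.1‖ + t * ‖p.2‖ := by
        gcongr
        · exact min_le_left _ _
        · exact min_le_right _ _
    _ = _ := by rw [one_mul]

theorem K_le_norm (C : CompatibleCouple 𝕜 X₀ X₁ E) (x : X₀) (t : ℝ) :
    C.K (C.ι₀ x) t ≤ ENNReal.ofReal ‖x‖ :=
  (iInf₂_le (x, 0) (by simp)).trans (by simp)

/-- For t ≥ 1 the contractive embedding gives K ≥ ‖x‖, so x + 0 is optimal. For t < 1 and x ≠ 0, K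
is positive and finite, so some decomposition stays below 2K. The clause for t ≥ 1 lets the later
telescoping sum start at x itself. -/
theorem exists_decomposition (C : CompatibleCouple 𝕜 X₀ X₁ E)
    (hC : ∀ y, ∃ x, C.ι₀ x = C.ι₁ y ∧ ‖x‖ ≤ ‖y‖) (x : X₀) {t : ℝ} (ht : 0 < t) :
    ∃ p : X₀ × X₁, C.ι₀ x = C.ι₀ p.1 + C.ι₁ p.2 ∧ (1 ≤ t → p.1 = x) ∧
      ENNReal.ofReal (‖p.1‖ + t * ‖p.2‖) ≤ 2 * C.K (C.ι₀ x) t := by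
  have h := C.min_mul_norm_le_K hC x ht
  rcases le_or_gt 1 t with h1 | h1
  · refine ⟨(x, 0), by simp, fun _ => rfl, ?_⟩
    rw [min_eq_left h1, one_mul] at h
    simp only [norm_zero, mul_zero, add_zero]
    exact h.trans (le_mul_of_one_le_left zero_le (by norm_num))
  · rcases eq_or_ne x 0 with rfl | hx
    · exact ⟨(0, 0), by simp, fun _ => rfl, by simp⟩
    · have hK0 : C.K (C.ι₀ x) t ≠ 0 := by
        refine (lt_of_lt_of_le ?_ h).ne'
        have : 0 < ‖x‖ := norm_pos_iff.2 hx
        rw [ENNReal.ofReal_pos]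
        positivity
      have hK1 : C.K (C.ι₀ x) t ≠ ∞ := ((C.K_le_norm x t).trans_lt ENNReal.ofReal_lt_top).ne
      have h2 : C.K (C.ι₀ x) t < 2 * C.K (C.ι₀ x) t := by
        rw [two_mul]
        exact ENNReal.lt_add_right hK1 hK0
      obtain ⟨p, hp⟩ := iInf_lt_iff.1 h2
      obtain ⟨hp', hp⟩ := iInf_lt_iff.1 hp
      exact ⟨p, hp', fun h3 => absurd h3 (not_le.2 h1), hp.le⟩

section RealScalars

variable [NormedSpace ℝ X₀] [IsScalarTower ℝ 𝕜 X₀] [NormedSpace ℝ X₁] [IsScalarTower ℝ 𝕜 X₁]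

theorem J_smul (C : CompatibleCouple 𝕜 X₀ X₁ E) {r : ℝ} (hr : 0 ≤ r) (y : C.Inter) (t : ℝ) :
    C.J (r • y) t = r * C.J y t := by
  change max ‖r • y.1.1‖ (t * ‖r • y.1.2‖) = _
  rw [norm_smul, norm_smul, Real.norm_of_nonneg hr, J, mul_max_of_nonneg _ _ hr]
  congr 1
  ring

variable [IsTopologicalAddGroup E] [T2Space E] [CompleteSpace X₀]

/-- A series in `X₀` with terms in `X₀ ∩ X₁` is represented by a step-like function. -/
theorem exists_isRepresentation_of_hasSum [CompleteSpace X₁] (C : CompatibleCouple 𝕜 X₀ X₁ E)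
    {S : ℕ → Set ℝ} (hS : ∀ m, MeasurableSet (S m)) (hd : Pairwise (Function.onFun Disjoint S))
    (hS0 : ∀ m, S m ⊆ Ioi 0) {φ : ℝ → ℝ} (hφ : AEMeasurable φ (volume.restrict (Ioi 0)))
    (hφ0 : ∀ s, 0 < s → 0 ≤ φ s) {c : ℕ → ℝ} (hc : ∀ m, 0 ≤ c m)
    (h1 : ∀ m, ∫⁻ s in S m, ENNReal.ofReal (s⁻¹ * (c m * φ s)) = 1) {w : ℕ → C.Inter} {x : X₀}
    (hw : HasSum (fun m => (w m).1.1) x) (hw' : ∑' m, ‖(w m).1.1‖ₑ ≠ ∞) :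
    ∃ u, C.IsRepresentation (C.ι₀ x) u ∧ (∀ m, ∀ s ∈ S m, u s = (c m * φ s) • w m) ∧
      ∀ s, (∀ m, s ∉ S m) → u s = 0 := by
  classical
  set u : ℝ → C.Inter := fun s =>
    if h : ∃ m, s ∈ S m then (c h.choose * φ s) • w h.choose else 0 with hu
  have hu1 : ∀ m, ∀ s ∈ S m, u s = (c m * φ s) • w m := by
    intro m s hs
    have h : ∃ m, s ∈ S m := ⟨m, hs⟩
    have hm : h.choose = m := by
      by_contra hne
      exact Set.disjoint_left.1 (hd hne) h.choose_spec hs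
    simp only [hu, dif_pos h]
    rw [hm]
  have hu0 : ∀ s, (∀ m, s ∉ S m) → u s = 0 := fun s hs => by
    simp only [hu]
    rw [dif_neg (by simpa using hs)]
  have hSU := MeasurableSet.iUnion hS
  have hm : AEStronglyMeasurable u (volume.restrict (Ioi 0)) := by
    have e : (⋃ m, S m).indicator u = u := by
      rw [indicator_eq_self]
      intro s hs
      by_contra hn
      exact hs (hu0 s (by simpa using hn))
    rw [← e, aestronglyMeasurable_indicator_iff hSU]
    refine AEStronglyMeasurable.iUnion fun m => ?_
    have h2 : AEStronglyMeasurable (fun s => (c m * φ s) • w m)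
        ((volume.restrict (Ioi 0)).restrict (S m)) :=
      (hφ.const_mul (c m)).restrict.aestronglyMeasurable.smul_const _
    refine h2.congr ?_
    filter_upwards [ae_restrict_mem (hS m)] with s hs
    exact (hu1 m s hs).symm
  have hG : ∀ m, ∀ s ∈ S m, s⁻¹ • (u s).1.1 = (s⁻¹ * (c m * φ s)) • (w m).1.1 := by
    intro m s hs
    rw [hu1 m s hs, mul_smul s⁻¹]
    rfl
  have hnn : ∀ m, ∀ s ∈ S m, 0 ≤ s⁻¹ * (c m * φ s) := fun m s hs => by
    have h3 : 0 < s := hS0 m hs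
    have := hc m
    have := hφ0 s h3
    positivity
  have hmG : AEStronglyMeasurable (fun s => s⁻¹ • (u s).1.1) (volume.restrict (Ioi 0)) :=
    measurable_inv.aestronglyMeasurable.smul
      ((continuous_fst.comp continuous_subtype_val).comp_aestronglyMeasurable hm)
  -- By the normalization `h1`, the m-th block contributes exactly the X₀-norm of w m.
  have hi : IntegrableOn (fun s => s⁻¹ • (u s).1.1) (⋃ m, S m) := by
    refine ⟨hmG.mono_measure (Measure.restrict_mono (iUnion_subset hS0) le_rfl), ?_⟩
    refine lt_of_le_of_lt ((lintegral_iUnion_le _ _).trans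
      (ENNReal.tsum_le_tsum fun m => le_of_eq ?_)) hw'.lt_top
    calc ∫⁻ s in S m, ‖s⁻¹ • (u s).1.1‖ₑ
        = ∫⁻ s in S m, ENNReal.ofReal (s⁻¹ * (c m * φ s)) * ‖(w m).1.1‖ₑ :=
          setLIntegral_congr_fun (hS m) fun s hs => by
            rw [hG m s hs, enorm_smul, Real.enorm_of_nonneg (hnn m s hs)]
      _ = ‖(w m).1.1‖ₑ := by
          rw [lintegral_mul_const' _ _ enorm_ne_top, h1, one_mul]
  have hz : ∀ s ∈ Ioi (0 : ℝ) \ ⋃ m, S m, s⁻¹ • (u s).1.1 = 0 := fun s hs => by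
    rw [hu0 s (by simpa using hs.2)]
    simp
  have hI : ∫ s in Ioi (0 : ℝ), s⁻¹ • (u s).1.1 = x := by
    rw [setIntegral_eq_of_subset_of_forall_sdiff_eq_zero measurableSet_Ioi (iUnion_subset hS0) hz]
    refine (hasSum_integral_iUnion hS hd hi).unique ?_
    convert hw using 2 with m
    rw [setIntegral_congr_fun (hS m) (hG m), integral_smul_const,
      integral_eq_lintegral_of_nonneg_ae, h1 m]
    · simp
    · filter_upwards [ae_restrict_mem (hS m)] with s hs using hnn m s hs
    · exact (measurable_inv.aemeasurable.mul ((hφ.mono_measure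
        (Measure.restrict_mono (hS0 m) le_rfl)).const_mul (c m))).aestronglyMeasurable
  refine ⟨u, ?_, hu1, hu0⟩
  rw [C.isRepresentation_iff hm (hi.of_forall_sdiff_eq_zero measurableSet_Ioi hz), hI]

/-- Telescope nearly optimal decompositions at points where Φ is halved, and spread the n-th
difference over the block two steps further down. The constant is 16 · 8: a pointwise bound by 16
times a forward average, whose L_q bound is 8. -/
theorem exists_jNorm_le_kNorm [CompleteSpace X₁]
    (C : CompatibleCouple 𝕜 X₀ X₁ E) (hC : ∀ y, ∃ x, C.ι₀ x = C.ι₁ y ∧ ‖x‖ ≤ ‖y‖)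
    {q : ℝ≥0∞} (hq : 1 < q) {p : ℝ} (hp : (1 / q).toReal * p + 1 = p)
    {A B : ℝ → ℝ} (hA : SlowlyVarying A) (hμ : IsHalfLineMeasure (weightMeasure A p))
    (hB : ∀ x, 0 < x →
      B x = A x ^ (-(p * (1 / q).toReal)) * ((weightMeasure A p).real (Iic x))⁻¹)
    {f : E} (hf : f ∈ C.kSpace 0 q B) :
    C.jNorm 0 q A f ≤ 128 * C.kNorm 0 q B f := by
  obtain ⟨⟨z, y, hzy⟩, hfin⟩ := hf
  obtain ⟨z', hz', -⟩ := hC y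
  obtain ⟨x, rfl⟩ : ∃ x, f = C.ι₀ x := ⟨z + z', by rw [hzy, map_add, hz']⟩
  rw [C.kNorm_eq_eLpNorm (by positivity) hA hμ hB] at hfin ⊢
  set μ := weightMeasure A p with hμdef
  obtain ⟨t, ht, ht0, ht1, hΦ⟩ := hμ.exists_seq
  set L := μ.real (Iic 1) with hL
  have hL0 : 0 < L := hμ.real_Iic_pos one_pos
  have hmI := IsHalfLineMeasure.measurable_Iic μ
  set k : ℝ → ℝ≥0∞ := fun s => (μ (Iic s))⁻¹ * C.K (C.ι₀ x) s with hk
  have hkm : Measurable k := hmI.inv.mul (C.measurable_K _)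
  -- Decomposition n is taken at t (n+1). As t 1 ≥ 1, the X₀-part of d 0 is x.
  choose d hd hd1 hdK using fun n : ℕ => C.exists_decomposition hC x (ht0 (n + 1))
  set κ : ℕ → ℝ≥0∞ := fun n => C.K (C.ι₀ x) (t (n + 1)) with hκ
  have hκanti : ∀ n, κ (n + 1) ≤ κ n := fun n => C.monotone_K _ (ht.antitone (by omega))
  set F : ℕ → Set ℝ := fun n => Ioc (t (n + 1)) (t n) with hF
  have hFm : ∀ n, MeasurableSet (F n) := fun n => measurableSet_Ioc
  have hFd : Pairwise (Function.onFun Disjoint F) := pairwise_disjoint_Ioc_of_antitone ht.antitone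
  have hμF : ∀ n, μ (F n) = ENNReal.ofReal (L * (1 / 2) ^ n) := fun n => by
    change μ (Ioc (t (n + 1)) (t n)) = _
    rw [show Ioc (t (n + 1)) (t n) = Iic (t n) \ Iic (t (n + 1)) by ext s; simp [and_comm],
      measure_sdiff (Iic_subset_Iic.2 (ht.antitone (by omega))) measurableSet_Iic.nullMeasurableSet
        (hμ.lt_top _).ne, hΦ, hΦ, ← ENNReal.ofReal_sub _ (by positivity)]
    congr 1
    ring
  -- On F n, K is at least κ n and Φ is at most Φ(t n) = 2 μ(F n), so k ≥ κ n / (2 μ(F n)) there.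
  have hκF : ∀ n, κ n ≤ 2 * ∫⁻ s in F n, k s ∂μ := fun n => by
    have hμF0 : μ (F n) ≠ 0 := by
      rw [hμF, ne_eq, ENNReal.ofReal_eq_zero, not_le]
      positivity
    have hμF1 : μ (F n) ≠ ∞ := by rw [hμF]; exact ENNReal.ofReal_ne_top
    have h2 : μ (Iic (t n)) = 2 * μ (F n) := by
      rw [hμF, hΦ, ← ENNReal.ofReal_ofNat 2, ← ENNReal.ofReal_mul (by norm_num)]
      congr 1
      ring
    calc κ n = 2 * ((2 * μ (F n))⁻¹ * κ n * μ (F n)) := by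
          rw [ENNReal.mul_inv (by simp) (by simp)]
          calc κ n = (2 * 2⁻¹) * (μ (F n) * (μ (F n))⁻¹) * κ n := by
                rw [ENNReal.mul_inv_cancel (by simp) (by simp), ENNReal.mul_inv_cancel hμF0 hμF1,
                  one_mul, one_mul]
            _ = _ := by ring
      _ = 2 * ∫⁻ _ in F n, (μ (Iic (t n)))⁻¹ * κ n ∂μ := by rw [setLIntegral_const, h2]
      _ ≤ _ := by
          refine mul_le_mul' le_rfl (setLIntegral_mono' (hFm n) fun s hs => ?_)
          rw [hk]
          refine mul_le_mul' (ENNReal.inv_le_inv.2 (measure_mono (Iic_subset_Iic.2 hs.2)))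
            (C.monotone_K _ hs.1.le)
  -- The blocks lie in (0, t 0], which has finite mass, so k is integrable over their union by
  -- Hölder.
  have hsumκ : ∑' n, κ n ≠ ∞ := by
    have h3 : ∫⁻ s in ⋃ n, F n, k s ∂μ < ∞ := by
      have h4 : (⋃ n, F n) ⊆ Iic (t 0) := iUnion_subset fun n s hs =>
        hs.2.trans (ht.antitone (Nat.zero_le n))
      have h5 := eLpNorm_le_eLpNorm_mul_rpow_measure_univ (μ := μ.restrict (Iic (t 0))) hq.le
        hkm.aestronglyMeasurable
      rw [eLpNorm_one_eq_lintegral_enorm] at h5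
      simp only [enorm_eq_self, ENNReal.toReal_one, Measure.restrict_apply_univ, div_one] at h5
      refine (lintegral_mono_set h4).trans_lt (h5.trans_lt (ENNReal.mul_lt_top ?_ ?_))
      · exact (eLpNorm_mono_measure _ Measure.restrict_le_self).trans_lt hfin
      · refine ENNReal.rpow_lt_top_of_nonneg ?_ (hμ.lt_top _).ne
        rcases eq_or_ne q ∞ with rfl | hq'
        · simp
        · have : 1 ≤ q.toReal := by
            rw [← ENNReal.toReal_one]
            exact ENNReal.toReal_mono hq' hq.le
          rw [sub_nonneg, div_le_one (by linarith)]
          exact this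
    rw [lintegral_iUnion hFm hFd] at h3
    refine ne_top_of_le_ne_top (ENNReal.mul_ne_top (a := 2) (by simp) h3.ne) ?_
    rw [← ENNReal.tsum_mul_left]
    exact ENNReal.tsum_le_tsum hκF
  have hdn : ∀ n, ENNReal.ofReal ‖(d n).1‖ ≤ 2 * κ n := fun n =>
    (ENNReal.ofReal_le_ofReal (le_add_of_nonneg_right
      (mul_nonneg (ht0 _).le (norm_nonneg _)))).trans (hdK n)
  have hdn2 : ∀ n, ENNReal.ofReal (t (n + 1) * ‖(d n).2‖) ≤ 2 * κ n := fun n =>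
    (ENNReal.ofReal_le_ofReal (le_add_of_nonneg_left (norm_nonneg _))).trans (hdK n)
  -- The two components are the same element of E, because both decompositions sum to f.
  set w : ℕ → C.Inter := fun n => ⟨((d n).1 - (d (n + 1)).1, (d (n + 1)).2 - (d n).2), by
    change C.ι₀ ((d n).1 - (d (n + 1)).1) = C.ι₁ ((d (n + 1)).2 - (d n).2)
    rw [map_sub, map_sub, sub_eq_sub_iff_add_eq_add, ← hd n, add_comm, ← hd (n + 1)]⟩ with hw
  -- The restriction s ≤ t (n+2) lets both X₁-parts be paired with the points at which they were
  -- chosen. Each of the two decompositions costs 2, hence 4.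
  have hwJ : ∀ n s, s ≤ t (n + 2) → ENNReal.ofReal (C.J (w n) s) ≤ 4 * κ n := fun n s hs => by
    have e4 : 4 * κ n = 2 * κ n + 2 * κ n := by rw [← add_mul]; norm_num
    rw [J, ENNReal.ofReal_max, max_le_iff]
    constructor
    · calc ENNReal.ofReal ‖(d n).1 - (d (n + 1)).1‖
          ≤ ENNReal.ofReal (‖(d n).1‖ + ‖(d (n + 1)).1‖) :=
            ENNReal.ofReal_le_ofReal (norm_sub_le _ _)
        _ ≤ 2 * κ n + 2 * κ (n + 1) := by
            rw [ENNReal.ofReal_add (norm_nonneg _) (norm_nonneg _)]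
            exact add_le_add (hdn n) (hdn (n + 1))
        _ ≤ 4 * κ n := by rw [e4]; gcongr; exact hκanti n
    · calc ENNReal.ofReal (s * ‖(d (n + 1)).2 - (d n).2‖)
          ≤ ENNReal.ofReal (t (n + 1 + 1) * ‖(d (n + 1)).2‖ + t (n + 1) * ‖(d n).2‖) := by
            refine ENNReal.ofReal_le_ofReal ?_
            calc s * ‖(d (n + 1)).2 - (d n).2‖
                ≤ t (n + 2) * (‖(d (n + 1)).2‖ + ‖(d n).2‖) := by
                  have := (ht0 (n + 2)).le
                  gcongr
                  exact norm_sub_le _ _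
              _ ≤ _ := by
                  rw [mul_add]
                  gcongr
                  exact ht.antitone (by omega)
        _ ≤ 2 * κ (n + 1) + 2 * κ n := by
            rw [ENNReal.ofReal_add (mul_nonneg (ht0 _).le (norm_nonneg _))
              (mul_nonneg (ht0 _).le (norm_nonneg _))]
            exact add_le_add (hdn2 (n + 1)) (hdn2 n)
        _ ≤ 4 * κ n := by rw [e4]; gcongr; exact hκanti n
  have hwsum : ∑' n, ‖(w n).1.1‖ₑ ≠ ∞ := by
    refine ne_top_of_le_ne_top (ENNReal.mul_ne_top (a := 4) (by simp) hsumκ) ?_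
    rw [← ENNReal.tsum_mul_left]
    refine ENNReal.tsum_le_tsum fun n => ?_
    rw [← ofReal_norm]
    exact (ENNReal.ofReal_le_ofReal (le_max_left _ _)).trans (hwJ n (t (n + 2)) le_rfl)
  have hwx : HasSum (fun n => (w n).1.1) x := by
    have hs : Summable fun n => (w n).1.1 := by
      refine Summable.of_norm ?_
      have := ENNReal.summable_toReal hwsum
      simpa using this
    rw [hs.hasSum_iff_tendsto_nat]
    have h6 : (fun n => ∑ i ∈ Finset.range n, (w i).1.1) = fun n => (d 0).1 - (d n).1 := by
      ext n
      exact Finset.sum_range_sub' (fun n => (d n).1) n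
    rw [h6, hd1 0 ht1]
    -- The remainder of the telescoping sum is at most 2 κ n, the general term of a convergent
    -- series.
    have h7 : Filter.Tendsto (fun n => (d n).1) Filter.atTop (nhds 0) := by
      rw [tendsto_zero_iff_norm_tendsto_zero]
      have h8 := ENNReal.Tendsto.const_mul (a := 2)
        (ENNReal.tendsto_atTop_zero_of_tsum_ne_top hsumκ) (Or.inr (by simp))
      rw [mul_zero] at h8
      have h9 := tendsto_of_tendsto_of_tendsto_of_le_of_le tendsto_const_nhds h8
        (fun _ => zero_le) hdn
      have h10 := (ENNReal.tendsto_toReal ENNReal.zero_ne_top).comp h9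
      simpa [Function.comp_def] using h10
    simpa using h7.const_sub x
  have hAp : ∀ s, 0 < s → 0 < A s ^ (-p) := fun s hs => Real.rpow_pos_of_pos (hA.pos s hs) _
  -- This is 1/μ(F (n+2)), so that c n · A^(-p) has integral 1 over F (n+2) with respect to ds/s.
  set c : ℕ → ℝ := fun n => (L * (1 / 2) ^ (n + 2))⁻¹ with hc
  have hc0 : ∀ n, 0 < c n := fun n => by positivity
  have hFs : ∀ n, F (n + 2) ⊆ Ioi 0 := fun n s hs => (ht0 _).trans hs.1
  obtain ⟨u, hu, hu1, hu0⟩ := C.exists_isRepresentation_of_hasSum (S := fun n => F (n + 2))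
    (fun n => hFm _) (fun m n hmn => hFd (by simpa using hmn)) hFs
    (hA.measurable.pow_const (-p)) (fun s hs => (hAp s hs).le) (fun n => (hc0 n).le)
    (fun n => by
      have e : ∀ s, s⁻¹ * (c n * A s ^ (-p)) = c n * (s⁻¹ * A s ^ (-p)) := fun s => by ring
      simp only [e, ENNReal.ofReal_mul (hc0 n).le]
      rw [lintegral_const_mul' _ _ ENNReal.ofReal_ne_top, ← inter_eq_left.2 (hFs n),
        ← weightMeasure_apply hA.measurable (hFm _), ← hμdef, hμF,
        ← ENNReal.ofReal_mul (hc0 n).le, hc, inv_mul_cancel₀ (by positivity)]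
      simp) hwx hwsum
  refine (iInf₂_le u hu).trans ?_
  rw [C.eLpNorm_mul_J hA.pos, eLpNorm_rpow_mul_weight hA.pos hA.measurable (by positivity) hp]
  -- Here 16 = 2 · 4 · 2: c n ≤ 2/Φ(s), then J(w n, s) ≤ 4 κ n, then κ n ≤ 2 ∫ k over F n. On F n
  -- one has Φ ≤ Φ(t n) = 8 Φ(t (n+3)) ≤ 8 Φ(s).
  have hpt : ∀ᵐ s ∂μ, ENNReal.ofReal (A s ^ p) * ENNReal.ofReal (C.J (u s) s) ≤
      16 * ((μ (Iic s))⁻¹ * ∫⁻ t in {t | μ (Iic s) ≤ μ (Iic t) ∧ μ (Iic t) ≤ 8 * μ (Iic s)},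
        k t ∂μ) := by
    filter_upwards [hμ.ae_pos] with s hs
    by_cases hsn : ∃ n, s ∈ F (n + 2)
    · obtain ⟨n, hsn⟩ := hsn
      have hAs := hA.pos s hs
      have hcμ : ENNReal.ofReal (c n) ≤ 2 * (μ (Iic s))⁻¹ := by
        have h11 : μ (Iic s) ≤ 2 * ENNReal.ofReal (c n)⁻¹ := by
          refine (measure_mono (Iic_subset_Iic.2 hsn.2)).trans (le_of_eq ?_)
          rw [hΦ, ← ENNReal.ofReal_ofNat 2, ← ENNReal.ofReal_mul (by norm_num), hc, inv_inv]
          congr 1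
          ring
        rw [ENNReal.ofReal_inv_of_pos (hc0 n)] at h11
        have h12 := ENNReal.inv_le_inv.2 h11
        rw [ENNReal.mul_inv (by simp) (by simp), inv_inv] at h12
        calc ENNReal.ofReal (c n) = 2 * (2⁻¹ * ENNReal.ofReal (c n)) := by
              rw [← mul_assoc, ENNReal.mul_inv_cancel (by simp) (by simp), one_mul]
          _ ≤ _ := by gcongr
      have hFS : F n ⊆ {t | μ (Iic s) ≤ μ (Iic t) ∧ μ (Iic t) ≤ 8 * μ (Iic s)} := by
        intro r hr
        refine ⟨measure_mono (Iic_subset_Iic.2 ?_), ?_⟩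
        · exact hsn.2.trans ((ht.antitone (by omega)).trans hr.1.le)
        · calc μ (Iic r) ≤ μ (Iic (t n)) := measure_mono (Iic_subset_Iic.2 hr.2)
            _ = 8 * μ (Iic (t (n + 2 + 1))) := by
                rw [hΦ, hΦ, ← ENNReal.ofReal_ofNat 8, ← ENNReal.ofReal_mul (by norm_num)]
                congr 1
                ring
            _ ≤ _ := by
                gcongr
                exact hsn.1.le
      rw [hu1 n s hsn, J_smul C (mul_nonneg (hc0 n).le (hAp s hs).le),
        ← ENNReal.ofReal_mul (by positivity)]
      rw [show A s ^ p * (c n * A s ^ (-p) * C.J (w n) s) =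
        A s ^ p * A s ^ (-p) * (c n * C.J (w n) s) by ring, ← Real.rpow_add hAs, add_neg_cancel,
        Real.rpow_zero, one_mul, ENNReal.ofReal_mul (hc0 n).le]
      calc ENNReal.ofReal (c n) * ENNReal.ofReal (C.J (w n) s)
          ≤ 2 * (μ (Iic s))⁻¹ * (4 * (2 * ∫⁻ s in F n, k s ∂μ)) := by
            refine mul_le_mul' hcμ ((hwJ n s hsn.2).trans ?_)
            gcongr
            exact hκF n
        _ ≤ 2 * (μ (Iic s))⁻¹ * (4 * (2 * ∫⁻ t in {t | μ (Iic s) ≤ μ (Iic t) ∧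
              μ (Iic t) ≤ 8 * μ (Iic s)}, k t ∂μ)) := by
            gcongr
        _ = _ := by ring
    · rw [hu0 s (by simpa using hsn)]
      simp [J]
  calc _ ≤ 16 * eLpNorm (fun s => (μ (Iic s))⁻¹ * ∫⁻ t in {t | μ (Iic s) ≤ μ (Iic t) ∧
        μ (Iic t) ≤ 8 * μ (Iic s)}, k t ∂μ) q μ :=
        eLpNorm_le_mul_eLpNorm_of_ae_le_mul' (c := 16)
          (by simpa only [enorm_eq_self, ENNReal.coe_ofNat] using hpt) q
    _ ≤ 16 * (8 * eLpNorm k q μ) := by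
        gcongr
        exact hμ.eLpNorm_forward_average_le hq hkm.aemeasurable
    _ = _ := by rw [← mul_assoc]; norm_num

end RealScalars

end CompatibleCouple

/-! ### Equality of the two J-spaces -/

theorem SlowlyVarying.exists_le_of_mem_Ioc {b : ℝ → ℝ} (hb : SlowlyVarying b) {x y : ℝ}
    (hx : 0 < x) : ∃ M : ℝ, 0 < M ∧ ∀ t ∈ Ioc x y, b t ≤ M := by
  rcases le_or_gt y x with hxy | hxy
  · exact ⟨1, one_pos, fun t ht => absurd (ht.1.trans_le ht.2) (not_lt.2 hxy)⟩
  obtain ⟨C, hC, h⟩ := hb.exists_le_mul_rpow one_pos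
  have hy := hx.trans hxy
  have hby := hb.pos y hy
  refine ⟨C * (y / x) * b y, by positivity, fun t ht => ?_⟩
  have ht0 := hx.trans ht.1
  refine (h t y ht0 ht.2).trans ?_
  rw [Real.rpow_one]
  gcongr
  exact ht.1.le

/-- Beyond 1 the J-functional of (X₀, X₀ ∩ X₁) is t times a norm, so the effective weight in
Hölder's inequality is tA(t). Since p ≥ 1, the integrand decays at least like t^(-3/2). -/
theorem SlowlyVarying.weightMeasure_id_mul_lt_top {A : ℝ → ℝ} (hA : SlowlyVarying A) {p : ℝ}
    (hp : 1 ≤ p) : weightMeasure (fun t => t * A t) p (Ioi 1) < ∞ := by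
  have hp0 : 0 < p := one_pos.trans_le hp
  obtain ⟨C, hC, h⟩ := hA.exists_rpow_neg_le hp0
  have hA1 : 0 < A 1 ^ (-p) := Real.rpow_pos_of_pos (hA.pos 1 one_pos) _
  rw [weightMeasure_apply (b := fun t => t * A t) (measurable_id.aemeasurable.mul hA.measurable) measurableSet_Ioi,
    inter_eq_left.2 (Ioi_subset_Ioi zero_le_one)]
  calc ∫⁻ t in Ioi 1, ENNReal.ofReal (t⁻¹ * (t * A t) ^ (-p))
      ≤ ∫⁻ t in Ioi 1, ENNReal.ofReal (C * A 1 ^ (-p)) *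
          ENNReal.ofReal (t ^ (-1 - 1 / 2 : ℝ)) := by
        refine setLIntegral_mono' measurableSet_Ioi fun t ht => ?_
        have ht1 : 1 < t := ht
        have ht0 : 0 < t := one_pos.trans ht1
        have hAt : 0 < A t ^ (-p) := Real.rpow_pos_of_pos (hA.pos t ht0) _
        rw [← ENNReal.ofReal_mul (by positivity)]
        refine ENNReal.ofReal_le_ofReal ?_
        have h1 := h 1 t one_pos ht1.le
        rw [div_one] at h1
        have h2 : t ^ (-p) ≤ t⁻¹ := by
          rw [← Real.rpow_neg_one]
          exact Real.rpow_le_rpow_of_exponent_le ht1.le (by linarith)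
        have e1 : t ^ (-1 - 1 / 2 : ℝ) = t⁻¹ * t⁻¹ * t ^ (1 / 2 : ℝ) := by
          rw [← Real.rpow_neg_one t, ← Real.rpow_add ht0, ← Real.rpow_add ht0]
          norm_num
        rw [Real.mul_rpow ht0.le (hA.pos t ht0).le, e1]
        calc t⁻¹ * (t ^ (-p) * A t ^ (-p))
            ≤ t⁻¹ * (t⁻¹ * (C * t ^ (1 / 2 : ℝ) * A 1 ^ (-p))) := by gcongr
          _ = _ := by ring
    _ ≤ ∫⁻ t in Ici 1, ENNReal.ofReal (C * A 1 ^ (-p)) *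
          ENNReal.ofReal (t ^ (-1 - 1 / 2 : ℝ)) := lintegral_mono_set Ioi_subset_Ici_self
    _ < ∞ := by
        rw [lintegral_const_mul' _ _ ENNReal.ofReal_ne_top,
          lintegral_Ici_rpow_neg one_pos (by norm_num)]
        exact ENNReal.mul_lt_top ENNReal.ofReal_lt_top ENNReal.ofReal_lt_top

/-- The `L_q` norm of a function which agrees on `(0,1]` with a given one, is bounded on `(1,y]` and
vanishes afterwards. -/
theorem eLpNorm_le_add_of_le_on {q : ℝ≥0∞} (hq : 1 ≤ q) {F F' : ℝ → ℝ≥0∞} {y : ℝ} {D : ℝ≥0∞}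
    (hF : AEMeasurable F (volume.restrict (Ioi 0))) (h₁ : ∀ t ∈ Ioc 0 1, F' t ≤ F t)
    (h₂ : ∀ t ∈ Ioc 1 y, F' t ≤ D) (h₃ : ∀ t, 1 < t → y < t → F' t = 0) :
    eLpNorm F' q (volume.restrict (Ioi 0)) ≤ eLpNorm F q (volume.restrict (Ioi 0)) +
      D * ENNReal.ofReal (y - 1) ^ (1 / q.toReal) := by
  calc eLpNorm F' q (volume.restrict (Ioi 0))
      ≤ eLpNorm (F + (Ioc 1 y).indicator fun _ => D) q (volume.restrict (Ioi 0)) := by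
        refine eLpNorm_mono_enorm_ae ?_
        filter_upwards [ae_restrict_mem measurableSet_Ioi] with t ht
        simp only [enorm_eq_self, Pi.add_apply]
        rcases le_or_gt t 1 with h1 | h1
        · exact (h₁ t ⟨ht, h1⟩).trans le_self_add
        rcases le_or_gt t y with h2 | h2
        · rw [indicator_of_mem (show t ∈ Ioc 1 y from ⟨h1, h2⟩)]
          exact (h₂ t ⟨h1, h2⟩).trans le_add_self
        · rw [h₃ t h1 h2]
          exact zero_le
    _ ≤ eLpNorm F q (volume.restrict (Ioi 0)) +
          eLpNorm ((Ioc 1 y).indicator fun _ => D) q (volume.restrict (Ioi 0)) :=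
        eLpNorm_add_le hF.aestronglyMeasurable
          (measurable_const.indicator measurableSet_Ioc).aestronglyMeasurable hq
    _ ≤ _ := by
        gcongr
        refine (eLpNorm_indicator_const_le _ _).trans ?_
        rw [enorm_eq_self]
        gcongr
        rw [← Real.volume_Ioc]
        exact Measure.restrict_le_self _

namespace CompatibleCouple

variable {𝕜 X₀ X₁ E : Type*} [RCLike 𝕜]
  [NormedAddCommGroup X₀] [NormedSpace 𝕜 X₀] [NormedAddCommGroup X₁] [NormedSpace 𝕜 X₁]
  [AddCommGroup E] [Module 𝕜 E] [TopologicalSpace E]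

theorem completeSpace_inter [T2Space E] [CompleteSpace X₀] [CompleteSpace X₁]
    (C : CompatibleCouple 𝕜 X₀ X₁ E) : CompleteSpace C.Inter := by
  have : IsClosed (C.Inter : Set (X₀ × X₁)) :=
    isClosed_eq (C.ι₀.continuous.comp continuous_fst) (C.ι₁.continuous.comp continuous_snd)
  exact this.completeSpace_coe

/-- An element of `X₀ ∩ X₁` as an element of `X₀ ∩ (X₀ ∩ X₁)`. -/
def toInterCouple (C : CompatibleCouple 𝕜 X₀ X₁ E) (y : C.Inter) : C.interCouple.Inter :=
  ⟨(y.1.1, y), rfl⟩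

theorem continuous_toInterCouple (C : CompatibleCouple 𝕜 X₀ X₁ E) :
    Continuous C.toInterCouple :=
  ((continuous_fst.comp continuous_subtype_val).prodMk continuous_id).subtype_mk _

theorem interCouple_fst_eq (C : CompatibleCouple 𝕜 X₀ X₁ E) (z : C.interCouple.Inter) :
    z.1.2.1.1 = z.1.1 :=
  C.injective₀ (Eq.symm z.2)

theorem norm_inter (C : CompatibleCouple 𝕜 X₀ X₁ E) (y : C.Inter) :
    ‖y‖ = max ‖y.1.1‖ ‖y.1.2‖ := rfl

theorem norm_le_J (C : CompatibleCouple 𝕜 X₀ X₁ E) (y : C.Inter) {t : ℝ} (ht : 1 ≤ t) :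
    ‖y‖ ≤ C.J y t := by
  rw [norm_inter, J]
  exact max_le_max le_rfl (le_mul_of_one_le_left (norm_nonneg _) ht)

theorem J_le_mul_norm (C : CompatibleCouple 𝕜 X₀ X₁ E) (y : C.Inter) {t : ℝ} (ht : 1 ≤ t) :
    C.J y t ≤ t * ‖y‖ := by
  rw [norm_inter, J, mul_max_of_nonneg _ _ (by linarith)]
  exact max_le_max (le_mul_of_one_le_left (norm_nonneg _) ht) le_rfl

theorem J_interCouple (C : CompatibleCouple 𝕜 X₀ X₁ E) (z : C.interCouple.Inter) (t : ℝ) :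
    C.interCouple.J z t = max ‖z.1.2.1.1‖ (t * ‖z.1.2‖) := by
  rw [interCouple_fst_eq]
  rfl

/-- The additional term t‖·‖ in X₀ is absorbed by the X₀-norm when t ≤ 1. -/
theorem J_interCouple_of_le_one (C : CompatibleCouple 𝕜 X₀ X₁ E) (z : C.interCouple.Inter) {t : ℝ}
    (ht0 : 0 ≤ t) (ht : t ≤ 1) : C.interCouple.J z t = C.J z.1.2 t := by
  rw [J_interCouple, norm_inter, J, mul_max_of_nonneg _ _ ht0, ← max_assoc,
    max_eq_left (mul_le_of_le_one_left (norm_nonneg _) ht)]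

theorem J_interCouple_of_one_le (C : CompatibleCouple 𝕜 X₀ X₁ E) (z : C.interCouple.Inter) {t : ℝ}
    (ht : 1 ≤ t) : C.interCouple.J z t = t * ‖z.1.2‖ := by
  rw [J_interCouple, max_eq_right]
  exact (le_max_left _ _).trans (le_mul_of_one_le_left (norm_nonneg z.1.2) ht)

section RealScalars

variable [NormedSpace ℝ X₀] [IsScalarTower ℝ 𝕜 X₀] [NormedSpace ℝ X₁] [IsScalarTower ℝ 𝕜 X₁]
  [CompleteSpace X₀] [CompleteSpace X₁]

/-- The part of `u` on `(1,∞)` is replaced by its integral, placed on `(1,e]`. -/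
theorem exists_integral_eq_and_eq_zero [T2Space E] (C : CompatibleCouple 𝕜 X₀ X₁ E)
    {u : ℝ → C.Inter} (hu : AEStronglyMeasurable u (volume.restrict (Ioi 0)))
    (h₀ : ∫⁻ s in Ioc 0 1, ENNReal.ofReal s⁻¹ * ‖(u s).1.1‖ₑ ≠ ∞)
    (h₁ : ∫⁻ s in Ioi 1, ENNReal.ofReal s⁻¹ * ‖u s‖ₑ ≠ ∞) :
    IntegrableOn (fun s => s⁻¹ • (u s).1.1) (Ioi 0) ∧
    ∃ w : ℝ → C.Inter, AEStronglyMeasurable w (volume.restrict (Ioi 0)) ∧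
      IntegrableOn (fun s => s⁻¹ • (w s).1.1) (Ioi 0) ∧
      ∫ s in Ioi (0 : ℝ), s⁻¹ • (w s).1.1 = ∫ s in Ioi (0 : ℝ), s⁻¹ • (u s).1.1 ∧
      (∀ s ≤ 1, w s = u s) ∧
      (∀ s ∈ Ioc 1 (Real.exp 1), ‖w s‖ₑ ≤ ∫⁻ s in Ioi 1, ENNReal.ofReal s⁻¹ * ‖u s‖ₑ) ∧
      ∀ s, 1 < s → Real.exp 1 < s → w s = 0 := by
  have := C.completeSpace_inter
  set P : C.Inter →L[ℝ] X₀ :=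
    (ContinuousLinearMap.fst 𝕜 X₀ X₁ ∘L C.Inter.subtypeL).restrictScalars ℝ with hP
  have hPf : ∀ y : C.Inter, P y = y.1.1 := fun _ => rfl
  have hmu : AEStronglyMeasurable (fun s => s⁻¹ • u s) (volume.restrict (Ioi 0)) :=
    measurable_inv.aestronglyMeasurable.smul hu
  have hmu0 : AEStronglyMeasurable (fun s => s⁻¹ • (u s).1.1) (volume.restrict (Ioi 0)) :=
    measurable_inv.aestronglyMeasurable.smul (P.continuous.comp_aestronglyMeasurable hu)
  have i₀ : IntegrableOn (fun s => s⁻¹ • (u s).1.1) (Ioc 0 1) := by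
    refine ⟨hmu0.mono_measure (Measure.restrict_mono Ioc_subset_Ioi_self le_rfl),
      lt_of_le_of_lt (le_of_eq ?_) h₀.lt_top⟩
    exact setLIntegral_congr_fun measurableSet_Ioc fun s hs => by
      rw [enorm_smul, Real.enorm_of_nonneg (inv_nonneg.2 hs.1.le)]
  have n₁ : ∫⁻ s in Ioi 1, ‖s⁻¹ • u s‖ₑ = ∫⁻ s in Ioi 1, ENNReal.ofReal s⁻¹ * ‖u s‖ₑ :=
    setLIntegral_congr_fun measurableSet_Ioi fun s hs => by
      have : (0 : ℝ) < s := one_pos.trans hs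
      rw [enorm_smul, Real.enorm_of_nonneg (inv_nonneg.2 this.le)]
  have i₁ : IntegrableOn (fun s => s⁻¹ • u s) (Ioi 1) :=
    ⟨hmu.mono_measure (Measure.restrict_mono (Ioi_subset_Ioi zero_le_one) le_rfl),
      lt_of_le_of_lt (le_of_eq n₁) h₁.lt_top⟩
  have i₁' : IntegrableOn (fun s => s⁻¹ • (u s).1.1) (Ioi 1) := by
    have h2 := P.integrable_comp i₁
    exact h2
  have iu : IntegrableOn (fun s => s⁻¹ • (u s).1.1) (Ioi 0) := by
    rw [← Ioc_union_Ioi_eq_Ioi zero_le_one]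
    exact i₀.union i₁'
  set g : C.Inter := ∫ s in Ioi (1 : ℝ), s⁻¹ • u s with hg
  have hgn : ‖g‖ₑ ≤ ∫⁻ s in Ioi 1, ENNReal.ofReal s⁻¹ * ‖u s‖ₑ := by
    rw [← n₁]
    exact enorm_integral_le_lintegral_enorm _
  have hg1 : g.1.1 = ∫ s in Ioi (1 : ℝ), s⁻¹ • (u s).1.1 := by
    rw [← hPf, hg, ← ContinuousLinearMap.integral_comp_comm _ i₁]
    rfl
  set w : ℝ → C.Inter := (Iic 1).indicator u + (Ioc 1 (Real.exp 1)).indicator fun _ => g with hw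
  have hw1 : ∀ s ≤ 1, w s = u s := fun s hs => by
    have : s ∉ Ioc 1 (Real.exp 1) := fun h => absurd h.1 (not_lt.2 hs)
    rw [hw, Pi.add_apply, indicator_of_mem (show s ∈ Iic 1 from hs), indicator_of_notMem this,
      add_zero]
  have hw2 : ∀ s ∈ Ioc 1 (Real.exp 1), w s = g := fun s hs => by
    rw [hw, Pi.add_apply, indicator_of_mem hs,
      indicator_of_notMem (show s ∉ Iic 1 from not_le.2 hs.1), zero_add]
  have hw3 : ∀ s, 1 < s → Real.exp 1 < s → w s = 0 := fun s hs hs' => by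
    have : s ∉ Ioc 1 (Real.exp 1) := fun h => absurd h.2 (not_le.2 hs')
    rw [hw, Pi.add_apply, indicator_of_notMem this,
      indicator_of_notMem (show s ∉ Iic 1 from not_le.2 hs), zero_add]
  have he : (1 : ℝ) ≤ Real.exp 1 := Real.one_le_exp zero_le_one
  have j₀ : IntegrableOn (fun s => s⁻¹ • (w s).1.1) (Ioc 0 1) :=
    i₀.congr_fun (fun s hs => by rw [hw1 s hs.2]) measurableSet_Ioc
  have hinv : IntegrableOn (fun s : ℝ => s⁻¹) (Ioc 1 (Real.exp 1)) := by
    rw [← intervalIntegrable_iff_integrableOn_Ioc_of_le he]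
    refine intervalIntegral.intervalIntegrable_inv (fun x hx => ?_) continuousOn_id
    rw [uIcc_of_le he] at hx
    exact (one_pos.trans_le hx.1).ne'
  have j₁ : IntegrableOn (fun s => s⁻¹ • (w s).1.1) (Ioc 1 (Real.exp 1)) :=
    IntegrableOn.congr_fun (hinv.smul_const g.1.1) (fun s hs => by rw [hw2 s hs])
      measurableSet_Ioc
  have hz : ∀ s ∈ Ioi (1 : ℝ) \ Ioc 1 (Real.exp 1), s⁻¹ • (w s).1.1 = 0 := fun s hs => by
    rw [hw3 s hs.1 (not_le.1 fun h => hs.2 ⟨hs.1, h⟩)]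
    simp
  have j₂ := j₁.of_forall_sdiff_eq_zero measurableSet_Ioi hz
  -- The interval (1,e] is chosen for its unit mass under ds/s, so the constant value g reproduces
  -- the integral g.
  have hone : ∫ s in Ioc 1 (Real.exp 1), s⁻¹ = (1 : ℝ) := by
    rw [← intervalIntegral.integral_of_le he, integral_inv_of_pos one_pos (Real.exp_pos 1)]
    simp
  have hI : ∫ s in Ioi (1 : ℝ), s⁻¹ • (w s).1.1 = ∫ s in Ioi (1 : ℝ), s⁻¹ • (u s).1.1 := by
    rw [setIntegral_eq_of_subset_of_forall_sdiff_eq_zero measurableSet_Ioi Ioc_subset_Ioi_self hz,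
      setIntegral_congr_fun (g := fun s : ℝ => s⁻¹ • g.1.1) measurableSet_Ioc
        (fun s hs => by simp only [hw2 s hs]),
      integral_smul_const, hone, one_smul, hg1]
  have hdisj : Disjoint (Ioc (0 : ℝ) 1) (Ioi 1) := Ioc_disjoint_Ioi le_rfl
  refine ⟨iu, w, ?_, ?_, ?_, hw1, fun s hs => by rw [hw2 s hs]; exact hgn, hw3⟩
  · exact (hu.indicator measurableSet_Iic).add
      (aestronglyMeasurable_const.indicator measurableSet_Ioc)
  · rw [← Ioc_union_Ioi_eq_Ioi zero_le_one]
    exact j₀.union j₂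
  · rw [← Ioc_union_Ioi_eq_Ioi zero_le_one, setIntegral_union hdisj measurableSet_Ioi j₀ j₂,
      setIntegral_union hdisj measurableSet_Ioi i₀ i₁', hI,
      setIntegral_congr_fun measurableSet_Ioc (fun s hs => by rw [hw1 s hs.2])]

variable [IsTopologicalAddGroup E] [T2Space E]

/-- For t ≥ 1, J(u(t),t) dominates the norm of the intersection, so finiteness of ∫ a^(-q') dt/t and
Hölder make the part of u beyond 1 integrable in X₀ ∩ X₁. It can then be collapsed onto (1,e]. -/
theorem exists_jNorm_interCouple_le (C : CompatibleCouple 𝕜 X₀ X₁ E) {q : ℝ≥0∞} (hq : 1 ≤ q)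
    {p : ℝ} (hp : (1 / q).toReal * p + 1 = p) {a A : ℝ → ℝ} (ha : SlowlyVarying a)
    (hA : SlowlyVarying A) (hAa : ∀ x ∈ Ioc (0 : ℝ) 1, A x = a x)
    (hfin : weightMeasure a p univ ≠ ∞) :
    ∃ c : ℝ≥0∞, c ≠ 0 ∧ c ≠ ∞ ∧
      ∀ f, C.interCouple.jNorm 0 q A f ≤ c * C.jNorm 0 q a f := by
  have := C.completeSpace_inter
  obtain ⟨M, hM, hMA⟩ := hA.exists_le_of_mem_Ioc (x := 1) (y := Real.exp 1) one_pos
  set m := weightMeasure a p univ ^ (1 - (1 / q).toReal) with hm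
  have hr0 : 0 ≤ (1 / q).toReal := ENNReal.toReal_nonneg
  have hr1 : (1 / q).toReal ≤ 1 := by
    rw [← ENNReal.toReal_one]
    exact ENNReal.toReal_mono (by simp) (by simpa using hq)
  have hmt : m ≠ ∞ := ENNReal.rpow_ne_top_of_nonneg (by linarith) hfin
  -- On (1,e] the weight is at most M and J is at most e times the norm; V is the L_q norm of the
  -- indicator of that interval.
  set D := ENNReal.ofReal (M * Real.exp 1) with hD
  set V := ENNReal.ofReal (Real.exp 1 - 1) ^ (1 / q.toReal) with hV
  have hVt : V ≠ ∞ := ENNReal.rpow_ne_top_of_nonneg (by positivity) ENNReal.ofReal_ne_top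
  have hct : 1 + D * m * V ≠ ∞ := by
    have : D ≠ ∞ := ENNReal.ofReal_ne_top
    finiteness
  refine ⟨1 + D * m * V, by simp, hct, fun f => C.le_mul_jNorm (by simp) hct fun u hu => ?_⟩
  rw [C.eLpNorm_mul_J ha.pos]
  set F : ℝ → ℝ≥0∞ := fun t => ENNReal.ofReal (t ^ (-0 - (1 / q).toReal) * a t) *
    ENNReal.ofReal (C.J (u t) t) with hF
  set N := eLpNorm F q (volume.restrict (Ioi 0)) with hN
  rcases eq_or_ne N ∞ with hNt | hNt
  · rw [hNt, ENNReal.mul_top (by simp)]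
    exact le_top
  have hJm := (C.aemeasurable_J hu.aestronglyMeasurable).ennreal_ofReal
  have hFm : AEMeasurable F (volume.restrict (Ioi 0)) :=
    ((measurable_id.pow_const _).aemeasurable.mul ha.measurable).ennreal_ofReal.mul hJm
  have holder := setLIntegral_inv_mul_le ha.pos ha.measurable hq hp hJm MeasurableSet.univ
  rw [univ_inter] at holder
  have hfinite : N * m ≠ ∞ := ENNReal.mul_ne_top hNt hmt
  have b₀ : ∫⁻ s in Ioc 0 1, ENNReal.ofReal s⁻¹ * ‖(u s).1.1‖ₑ ≤ N * m := by
    refine le_trans ?_ holder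
    refine le_trans (lintegral_mono_set Ioc_subset_Ioi_self) (lintegral_mono fun s => ?_)
    rw [← ofReal_norm]
    gcongr
    exact le_max_left _ _
  have b₁ : ∫⁻ s in Ioi 1, ENNReal.ofReal s⁻¹ * ‖u s‖ₑ ≤ N * m := by
    refine le_trans ?_ holder
    refine le_trans ?_ (lintegral_mono_set (Ioi_subset_Ioi zero_le_one))
    refine setLIntegral_mono' measurableSet_Ioi fun s hs => ?_
    rw [← ofReal_norm]
    gcongr
    exact C.norm_le_J _ (le_of_lt hs)
  obtain ⟨iu, w, hwm, hwi, hwI, hw1, hw2, hw3⟩ := C.exists_integral_eq_and_eq_zero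
    hu.aestronglyMeasurable (ne_top_of_le_ne_top hfinite b₀) (ne_top_of_le_ne_top hfinite b₁)
  have hrep : C.interCouple.IsRepresentation f fun s => C.toInterCouple (w s) := by
    rw [C.interCouple.isRepresentation_iff
      (C.continuous_toInterCouple.comp_aestronglyMeasurable hwm) hwi]
    rw [C.isRepresentation_iff hu.aestronglyMeasurable iu] at hu
    rw [hu, ← hwI]
    rfl
  refine (iInf₂_le _ hrep).trans ?_
  rw [C.interCouple.eLpNorm_mul_J hA.pos]
  refine (eLpNorm_le_add_of_le_on hq (y := Real.exp 1) (D := D * (N * m)) hFm ?_ ?_ ?_).trans ?_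
  · intro t ht
    rw [hF, C.J_interCouple_of_le_one _ ht.1.le ht.2, hAa t ht]
    simp only [toInterCouple, hw1 t ht.2]
    exact le_rfl
  · intro t ht
    have ht0 : 0 < t := one_pos.trans ht.1
    have hAt := hA.pos t ht0
    rw [C.J_interCouple_of_one_le _ ht.1.le]
    refine le_trans ?_ (mul_le_mul' le_rfl ((hw2 t ht).trans b₁))
    rw [hD, ← ofReal_norm, ← ENNReal.ofReal_mul (by positivity),
      ← ENNReal.ofReal_mul (by positivity)]
    refine ENNReal.ofReal_le_ofReal ?_
    have h4 : t ^ (-0 - (1 / q).toReal) ≤ 1 :=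
      Real.rpow_le_one_of_one_le_of_nonpos ht.1.le (by linarith)
    calc t ^ (-0 - (1 / q).toReal) * A t * (t * ‖(C.toInterCouple (w t)).1.2‖)
        ≤ 1 * M * (Real.exp 1 * ‖w t‖) := by
          gcongr
          · exact hMA t ht
          · exact ht.2
          · exact le_rfl
      _ = _ := by ring
  · intro t ht ht'
    rw [C.J_interCouple, hw3 t ht ht']
    simp [toInterCouple]
  · rw [add_mul, one_mul]
    refine add_le_add le_rfl (le_of_eq ?_)
    ring

/-- The same collapse in the opposite direction. Near 0 integrability uses the mass of A on (0,1];
beyond 1 it comes from the factor t in the J-functional, whatever the mass of A there. -/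
theorem exists_jNorm_le_jNorm_interCouple (C : CompatibleCouple 𝕜 X₀ X₁ E) {q : ℝ≥0∞} (hq : 1 ≤ q)
    {p : ℝ} (hp1 : 1 ≤ p) (hp : (1 / q).toReal * p + 1 = p) {a A : ℝ → ℝ} (ha : SlowlyVarying a)
    (hA : SlowlyVarying A) (hAa : ∀ x ∈ Ioc (0 : ℝ) 1, A x = a x)
    (hfin : weightMeasure A p (Iic 1) ≠ ∞) :
    ∃ c : ℝ≥0∞, c ≠ 0 ∧ c ≠ ∞ ∧
      ∀ f, C.jNorm 0 q a f ≤ c * C.interCouple.jNorm 0 q A f := by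
  have := C.completeSpace_inter
  obtain ⟨M, hM, hMa⟩ := ha.exists_le_of_mem_Ioc (x := 1) (y := Real.exp 1) one_pos
  have hr0 : 0 ≤ (1 / q).toReal := ENNReal.toReal_nonneg
  have hr1 : (1 / q).toReal ≤ 1 := by
    rw [← ENNReal.toReal_one]
    exact ENNReal.toReal_mono (by simp) (by simpa using hq)
  set m₀ := weightMeasure A p (Iic 1) ^ (1 - (1 / q).toReal) with hm₀
  have hm₀t : m₀ ≠ ∞ := ENNReal.rpow_ne_top_of_nonneg (by linarith) hfin
  set m := weightMeasure (fun t => t * A t) p (Ioi 1) ^ (1 - (1 / q).toReal) with hm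
  have hmt : m ≠ ∞ := ENNReal.rpow_ne_top_of_nonneg (by linarith)
    (hA.weightMeasure_id_mul_lt_top hp1).ne
  set D := ENNReal.ofReal (M * Real.exp 1) with hD
  set V := ENNReal.ofReal (Real.exp 1 - 1) ^ (1 / q.toReal) with hV
  have hVt : V ≠ ∞ := ENNReal.rpow_ne_top_of_nonneg (by positivity) ENNReal.ofReal_ne_top
  have hct : 1 + D * m * V ≠ ∞ := by
    have : D ≠ ∞ := ENNReal.ofReal_ne_top
    finiteness
  refine ⟨1 + D * m * V, by simp, hct,
    fun f => C.interCouple.le_mul_jNorm (by simp) hct fun u hu => ?_⟩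
  rw [C.interCouple.eLpNorm_mul_J hA.pos]
  set F : ℝ → ℝ≥0∞ := fun t => ENNReal.ofReal (t ^ (-0 - (1 / q).toReal) * A t) *
    ENNReal.ofReal (C.interCouple.J (u t) t) with hF
  set N := eLpNorm F q (volume.restrict (Ioi 0)) with hN
  rcases eq_or_ne N ∞ with hNt | hNt
  · rw [hNt, ENNReal.mul_top (by simp)]
    exact le_top
  have hJm := (C.interCouple.aemeasurable_J hu.aestronglyMeasurable).ennreal_ofReal
  have hFm : AEMeasurable F (volume.restrict (Ioi 0)) :=
    ((measurable_id.pow_const _).aemeasurable.mul hA.measurable).ennreal_ofReal.mul hJm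
  set v : ℝ → C.Inter := fun s => (u s).1.2 with hv
  have hvm : AEStronglyMeasurable v (volume.restrict (Ioi 0)) :=
    (continuous_snd.comp continuous_subtype_val).comp_aestronglyMeasurable hu.aestronglyMeasurable
  have b₀ : ∫⁻ s in Ioc 0 1, ENNReal.ofReal s⁻¹ * ‖(v s).1.1‖ₑ ≤ N * m₀ := by
    refine le_trans ?_
      (setLIntegral_inv_mul_le hA.pos hA.measurable hq hp hJm (measurableSet_Iic (a := 1)))
    rw [inter_comm, Ioi_inter_Iic]
    refine lintegral_mono fun s => ?_
    rw [← ofReal_norm, C.J_interCouple]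
    gcongr
    exact le_max_left _ _
  have b₁ : ∫⁻ s in Ioi 1, ENNReal.ofReal s⁻¹ * ‖v s‖ₑ ≤ N * m := by
    -- Moving a factor t from J to the weight leaves J/t, which is the norm of v(t) for t ≥ 1, and
    -- prepares Hölder with weight tA(t).
    have hNeq : N = eLpNorm (fun t => ENNReal.ofReal (t ^ (-0 - (1 / q).toReal) * (t * A t)) *
        (ENNReal.ofReal t⁻¹ * ENNReal.ofReal (C.interCouple.J (u t) t))) q
          (volume.restrict (Ioi 0)) := by
      refine eLpNorm_congr_ae ?_
      filter_upwards [ae_restrict_mem measurableSet_Ioi] with t ht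
      have ht : 0 < t := ht
      have := hA.pos t ht
      rw [hF, ← mul_assoc, ← ENNReal.ofReal_mul (by positivity)]
      field_simp
    rw [hNeq]
    refine le_trans ?_ (setLIntegral_inv_mul_le (fun t ht => mul_pos ht (hA.pos t ht))
      (measurable_id.aemeasurable.mul hA.measurable) hq hp
      (measurable_inv.ennreal_ofReal.aemeasurable.mul hJm) measurableSet_Ioi)
    rw [inter_eq_left.2 (Ioi_subset_Ioi zero_le_one)]
    refine setLIntegral_mono' measurableSet_Ioi fun s hs => ?_
    have hs0 : (0 : ℝ) < s := one_pos.trans hs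
    simp only [Pi.mul_apply]
    rw [← ENNReal.ofReal_mul (p := s⁻¹) (q := C.interCouple.J _ _) (by positivity), ← ofReal_norm]
    gcongr
    rw [C.J_interCouple_of_one_le _ (le_of_lt hs), inv_mul_cancel_left₀ hs0.ne']
  obtain ⟨iv, w, hwm, hwi, hwI, hw1, hw2, hw3⟩ := C.exists_integral_eq_and_eq_zero hvm
    (ne_top_of_le_ne_top (ENNReal.mul_ne_top hNt hm₀t) b₀)
    (ne_top_of_le_ne_top (ENNReal.mul_ne_top hNt hmt) b₁)
  have huv : ∀ s, (v s).1.1 = (u s).1.1 := fun s => C.interCouple_fst_eq _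
  have hrep : C.IsRepresentation f w := by
    rw [C.isRepresentation_iff hwm hwi]
    simp only [huv] at iv
    rw [C.interCouple.isRepresentation_iff hu.aestronglyMeasurable iv] at hu
    rw [hu, hwI]
    simp only [huv]
    rfl
  refine (iInf₂_le _ hrep).trans ?_
  rw [C.eLpNorm_mul_J ha.pos]
  refine (eLpNorm_le_add_of_le_on hq (y := Real.exp 1) (D := D * (N * m)) hFm ?_ ?_ ?_).trans ?_
  · intro t ht
    simp only [hF, C.J_interCouple_of_le_one _ ht.1.le ht.2, hAa t ht, hw1 t ht.2]
    exact le_rfl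
  · intro t ht
    have ht0 : 0 < t := one_pos.trans ht.1
    have hat := ha.pos t ht0
    refine le_trans ?_ (mul_le_mul' le_rfl ((hw2 t ht).trans b₁))
    rw [hD, ← ofReal_norm, ← ENNReal.ofReal_mul (by positivity),
      ← ENNReal.ofReal_mul (by positivity)]
    refine ENNReal.ofReal_le_ofReal ?_
    have h4 : t ^ (-0 - (1 / q).toReal) ≤ 1 :=
      Real.rpow_le_one_of_one_le_of_nonpos ht.1.le (by linarith)
    calc t ^ (-0 - (1 / q).toReal) * a t * C.J (w t) t
        ≤ 1 * M * (Real.exp 1 * ‖w t‖) := by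
          refine mul_le_mul (mul_le_mul h4 (hMa t ht) hat.le zero_le_one) ?_ (C.J_nonneg _ _)
            (by positivity)
          refine (C.J_le_mul_norm _ ht.1.le).trans ?_
          gcongr
          exact ht.2
      _ = _ := by ring
  · intro t ht ht'
    rw [hw3 t ht ht']
    simp [J]
  · rw [add_mul, one_mul]
    refine add_le_add le_rfl (le_of_eq ?_)
    ring

end RealScalars

end CompatibleCouple

/-! ### Hypotheses on the weights and assembly -/

theorem Coincide.of_le {E : Type*} {S T : Set E} {N M : E → ℝ≥0∞} (hST : S = T) {c₁ c₂ : ℝ≥0∞}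
    (hc₁ : c₁ ≠ ∞) (hc₂ : c₂ ≠ ∞) (h₁ : ∀ f ∈ S, N f ≤ c₁ * M f) (h₂ : ∀ f ∈ S, M f ≤ c₂ * N f) :
    Coincide S N T M := by
  have hc : c₁ + c₂ + 1 ≠ ∞ := by finiteness
  refine ⟨hST, (c₁ + c₂ + 1).toReal, ENNReal.toReal_pos (by simp) hc, fun f hf => ?_⟩
  rw [ENNReal.ofReal_toReal hc]
  refine ⟨(h₁ f hf).trans (mul_le_mul' ?_ le_rfl), (h₂ f hf).trans (mul_le_mul' ?_ le_rfl)⟩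
  · exact le_self_add.trans le_self_add
  · exact le_add_self.trans le_self_add

theorem EquivOn.exists_rpow_neg_le {s : Set ℝ} {f g : ℝ → ℝ} (h : EquivOn s f g)
    (hs : s ⊆ Ioi 0) (hf : ∀ t, 0 < t → 0 < f t) (hg : ∀ t, 0 < t → 0 < g t) {p : ℝ} (hp : 0 ≤ p) :
    ∃ c : ℝ, 0 < c ∧ ∀ t ∈ s, f t ^ (-p) ≤ c * g t ^ (-p) ∧ g t ^ (-p) ≤ c * f t ^ (-p) := by
  obtain ⟨c, hc, h⟩ := h
  have key : ∀ x y : ℝ, 0 < x → 0 < y → x ≤ c * y → y ^ (-p) ≤ c ^ p * x ^ (-p) := by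
    intro x y hx hy hxy
    have h1 := Real.rpow_le_rpow hx.le hxy hp
    rw [Real.mul_rpow hc.le hy.le] at h1
    have hx' := Real.rpow_pos_of_pos hx p
    have hy' := Real.rpow_pos_of_pos hy p
    rw [Real.rpow_neg hy.le, Real.rpow_neg hx.le, inv_le_iff_one_le_mul₀ hy',
      show c ^ p * (x ^ p)⁻¹ * y ^ p = c ^ p * y ^ p / x ^ p by ring, le_div_iff₀ hx', one_mul]
    exact h1
  exact ⟨c ^ p, by positivity, fun t ht =>
    ⟨key _ _ (hg t (hs ht)) (hf t (hs ht)) (h t ht).2,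
      key _ _ (hf t (hs ht)) (hg t (hs ht)) (h t ht).1⟩⟩

/-- Finiteness near 0 comes from a, and on bounded intervals beyond 1 from α. The total mass is
infinite because the integral for α converges near 0 and so must diverge over (1,∞), where A ≈ α. -/
theorem isHalfLineMeasure_weightMeasure {a α A : ℝ → ℝ} {p : ℝ} (hp : 0 ≤ p)
    (ha_int : ∫⁻ t in Ioi (0 : ℝ), ENNReal.ofReal (t⁻¹ * a t ^ (-p)) < ∞)
    (hα : SlowlyVarying α)
    (hα_int : ∀ x : ℝ, 0 < x → ∫⁻ t in Ioo (0 : ℝ) x, ENNReal.ofReal (t⁻¹ * α t ^ (-p)) < ∞)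
    (hα_top : ∫⁻ t in Ioi (0 : ℝ), ENNReal.ofReal (t⁻¹ * α t ^ (-p)) = ∞)
    (hA : SlowlyVarying A) (hAa : ∀ x ∈ Ioc (0 : ℝ) 1, A x = a x) (hAα : EquivOn (Ioi 1) A α) :
    IsHalfLineMeasure (weightMeasure A p) := by
  obtain ⟨c, hc, h⟩ :=
    hAα.exists_rpow_neg_le (Ioi_subset_Ioi zero_le_one) hA.pos hα.pos hp
  have comp : ∀ {f g : ℝ → ℝ}, (∀ t, 0 < t → 0 < g t) →
      (∀ t ∈ Ioi (1 : ℝ), f t ^ (-p) ≤ c * g t ^ (-p)) → ∀ s : Set ℝ, MeasurableSet s →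
      s ⊆ Ioi 1 → ∫⁻ t in s, ENNReal.ofReal (t⁻¹ * f t ^ (-p)) ≤
        ENNReal.ofReal c * ∫⁻ t in s, ENNReal.ofReal (t⁻¹ * g t ^ (-p)) := by
    intro f g hg hfg s hs hs1
    rw [← lintegral_const_mul' _ _ ENNReal.ofReal_ne_top]
    refine setLIntegral_mono' hs fun t ht => ?_
    have ht0 : (0 : ℝ) < t := one_pos.trans (hs1 ht)
    rw [← ENNReal.ofReal_mul hc.le]
    refine ENNReal.ofReal_le_ofReal ?_
    calc t⁻¹ * f t ^ (-p) ≤ t⁻¹ * (c * g t ^ (-p)) := by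
          gcongr
          exact hfg t (hs1 ht)
      _ = _ := by ring
  have happly := fun {s : Set ℝ} (hs : MeasurableSet s) =>
    weightMeasure_apply (p := p) hA.measurable hs
  refine ⟨?_, fun x => ?_, fun x hx => ?_, ?_⟩
  · rw [happly measurableSet_Iic, inter_comm, Ioi_inter_Iic]
    simp
  · rw [happly measurableSet_Iic]
    have hsub : Iic x ∩ Ioi 0 ⊆ Ioc 0 1 ∪ Ioc 1 x := fun t ht => by
      rcases le_or_gt t 1 with h1 | h1
      · exact Or.inl ⟨ht.2, h1⟩
      · exact Or.inr ⟨h1, ht.1⟩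
    refine (lintegral_mono_set hsub).trans_lt ((lintegral_union_le _ _ _).trans_lt
      (ENNReal.add_lt_top.2 ⟨?_, ?_⟩))
    · rw [setLIntegral_congr_fun (g := fun t => ENNReal.ofReal (t⁻¹ * a t ^ (-p)))
        measurableSet_Ioc (fun t ht => by simp only [hAa t ht])]
      exact (lintegral_mono_set Ioc_subset_Ioi_self).trans_lt ha_int
    · refine (comp hα.pos (fun t ht => (h t ht).1) _ measurableSet_Ioc
        Ioc_subset_Ioi_self).trans_lt (ENNReal.mul_lt_top ENNReal.ofReal_lt_top ?_)
      -- The endpoint max x 0 + 1 is positive for every real x and lies strictly beyond x, as the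
      -- open interval requires.
      refine (lintegral_mono_set fun t ht => ?_).trans_lt (hα_int (max x 0 + 1) (by positivity))
      refine ⟨one_pos.trans ht.1, ?_⟩
      have := ht.2.trans (le_max_left x 0)
      linarith
  · refine pos_iff_ne_zero.2 fun h0 => ?_
    have h1 := absolutelyContinuous_weightMeasure hA.pos hA.measurable h0
    rw [Measure.restrict_apply measurableSet_Iic, inter_comm, Ioi_inter_Iic, Real.volume_Ioc] at h1
    simp only [sub_zero, ENNReal.ofReal_eq_zero] at h1
    linarith
  · rw [happly MeasurableSet.univ, univ_inter]
    by_contra hne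
    have h1 : ∫⁻ t in Ioi (0 : ℝ), ENNReal.ofReal (t⁻¹ * α t ^ (-p)) < ∞ := by
      have hsub : Ioi (0 : ℝ) ⊆ Ioo 0 2 ∪ Ioi 1 := fun t ht => by
        rcases le_or_gt t 1 with h1 | h1
        · exact Or.inl ⟨ht, h1.trans_lt one_lt_two⟩
        · exact Or.inr h1
      refine (lintegral_mono_set hsub).trans_lt ((lintegral_union_le _ _ _).trans_lt
        (ENNReal.add_lt_top.2 ⟨hα_int 2 two_pos, ?_⟩))
      refine (comp hA.pos (fun t ht => (h t ht).2) _ measurableSet_Ioi le_rfl).trans_lt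
        (ENNReal.mul_lt_top ENNReal.ofReal_lt_top ?_)
      exact (lintegral_mono_set (Ioi_subset_Ioi zero_le_one)).trans_lt (lt_top_iff_ne_top.2 hne)
    exact h1.ne hα_top

theorem integral_Ioo_eq_weightMeasure_real {A : ℝ → ℝ} (hA : SlowlyVarying A) {p x : ℝ} :
    ∫ t in Ioo (0 : ℝ) x, t⁻¹ * A t ^ (-p) = (weightMeasure A p).real (Iic x) := by
  rw [Measure.real, weightMeasure_apply hA.measurable measurableSet_Iic, inter_comm, Ioi_inter_Iic,
    setLIntegral_congr Ioo_ae_eq_Ioc.symm, integral_eq_lintegral_of_nonneg_ae]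
  · filter_upwards [ae_restrict_mem measurableSet_Ioo] with t ht
    have := Real.rpow_pos_of_pos (hA.pos t ht.1) (-p)
    have := ht.1
    simp only [Pi.zero_apply]
    positivity
  · exact (measurable_inv.aemeasurable.mul ((hA.measurable.mono_measure
      (Measure.restrict_mono Ioo_subset_Ioi_self le_rfl)).pow_const _)).aestronglyMeasurable

/-- The relations between `q` and `p = q'` that are used, for `1 < q ≤ ∞`. -/
theorem ENNReal.HolderConjugate.toReal_relations {q q' : ℝ≥0∞} (h : q.HolderConjugate q')
    (hq : 1 < q) : 1 ≤ q'.toReal ∧ (1 / q).toReal * q'.toReal + 1 = q'.toReal ∧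
      (q' / q).toReal = q'.toReal * (1 / q).toReal := by
  have h1 := h.inv_add_inv_eq_one
  have hq1 : 1 ≤ q' := by
    rw [← ENNReal.inv_le_one, ← h1]
    exact le_add_self
  have hqt : q' ≠ ∞ := by
    rintro rfl
    rw [ENNReal.inv_top, add_zero, ENNReal.inv_eq_one] at h1
    exact hq.ne' h1
  have hp : 1 ≤ q'.toReal := by
    rw [← ENNReal.toReal_one]
    exact ENNReal.toReal_mono hqt hq1
  have hq0 : q ≠ 0 := (zero_lt_one.trans hq).ne'
  have h2 : (q⁻¹).toReal + (q'⁻¹).toReal = 1 := by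
    rw [← ENNReal.toReal_add (ENNReal.inv_ne_top.2 hq0)
      (ENNReal.inv_ne_top.2 (zero_lt_one.trans_le hq1).ne'), h1, ENNReal.toReal_one]
  refine ⟨hp, ?_, ?_⟩
  · rw [one_div]
    rw [ENNReal.toReal_inv q'] at h2
    have : q'.toReal ≠ 0 := by linarith
    rw [eq_sub_of_add_eq h2]
    field_simp
    ring
  · rw [div_eq_mul_inv, ENNReal.toReal_mul, one_div]

theorem theorem1p11 {𝕜 X₀ X₁ E : Type*} [RCLike 𝕜]
    [NormedAddCommGroup X₀] [NormedSpace 𝕜 X₀] [CompleteSpace X₀]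
    [NormedAddCommGroup X₁] [NormedSpace 𝕜 X₁] [CompleteSpace X₁]
    [AddCommGroup E] [Module 𝕜 E] [TopologicalSpace E]
    [IsTopologicalAddGroup E] [ContinuousSMul 𝕜 E] [T2Space E]
    (C : CompatibleCouple 𝕜 X₀ X₁ E)
    (q q' : ℝ≥0∞) (hq : 1 < q) (hqq' : q.HolderConjugate q')
    (a α A B : ℝ → ℝ)
    (ha : SlowlyVarying a)
    (ha_int : ∫⁻ t in Ioi (0 : ℝ), ENNReal.ofReal (t⁻¹ * a t ^ (-q'.toReal)) < ∞)
    (hα : SlowlyVarying α)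
    (hα_int : ∀ x : ℝ, 0 < x →
      ∫⁻ t in Ioo (0 : ℝ) x, ENNReal.ofReal (t⁻¹ * α t ^ (-q'.toReal)) < ∞)
    (hα_top : ∫⁻ t in Ioi (0 : ℝ), ENNReal.ofReal (t⁻¹ * α t ^ (-q'.toReal)) = ∞)
    (hA : SlowlyVarying A)
    (hAa : ∀ x ∈ Ioc (0 : ℝ) 1, A x = a x)
    (hAα : EquivOn (Ioi 1) A α)
    (hB : ∀ x : ℝ, 0 < x →
      B x = A x ^ (-(q' / q).toReal) * (∫ t in Ioo (0 : ℝ) x, t⁻¹ * A t ^ (-q'.toReal))⁻¹) :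
    Coincide (C.jSpace 0 q a) (C.jNorm 0 q a)
        (C.interCouple.jSpace 0 q A) (C.interCouple.jNorm 0 q A) ∧
      Coincide (C.interCouple.jSpace 0 q A) (C.interCouple.jNorm 0 q A)
        (C.interCouple.kSpace 0 q B) (C.interCouple.kNorm 0 q B) := by
  let _ : NormedSpace ℝ X₀ := NormedSpace.restrictScalars ℝ 𝕜 X₀
  let _ : NormedSpace ℝ X₁ := NormedSpace.restrictScalars ℝ 𝕜 X₁
  have : IsScalarTower ℝ 𝕜 X₀ := IsScalarTower.of_algebraMap_smul fun _ _ => rfl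
  have : IsScalarTower ℝ 𝕜 X₁ := IsScalarTower.of_algebraMap_smul fun _ _ => rfl
  have := C.completeSpace_inter
  obtain ⟨hp1, hp, hpr⟩ := hqq'.toReal_relations hq
  set p := q'.toReal
  have hp0 : 0 < p := one_pos.trans_le hp1
  have hμ := isHalfLineMeasure_weightMeasure hp0.le ha_int hα hα_int hα_top hA hAa hAα
  have hB' : ∀ x, 0 < x →
      B x = A x ^ (-(p * (1 / q).toReal)) * ((weightMeasure A p).real (Iic x))⁻¹ := fun x hx => by
    rw [hB x hx, hpr, integral_Ioo_eq_weightMeasure_real hA]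
  have hC : ∀ y, ∃ x, C.interCouple.ι₀ x = C.interCouple.ι₁ y ∧ ‖x‖ ≤ ‖y‖ := fun y =>
    ⟨y.1.1, rfl, le_max_left _ _⟩
  have hfin : weightMeasure a p univ ≠ ∞ := by
    rw [weightMeasure_apply ha.measurable MeasurableSet.univ, univ_inter]
    exact ha_int.ne
  obtain ⟨c₁, -, hc₁, h₁⟩ := C.exists_jNorm_interCouple_le hq.le hp ha hA hAa hfin
  obtain ⟨c₂, -, hc₂, h₂⟩ :=
    C.exists_jNorm_le_jNorm_interCouple hq.le hp1 hp ha hA hAa (hμ.lt_top 1).ne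
  obtain ⟨c₃, -, hc₃, h₃⟩ := C.interCouple.exists_kNorm_le_jNorm hq hp0 hp hA hμ hB'
  have h₄ := fun f (hf : f ∈ C.interCouple.kSpace 0 q B) =>
    C.interCouple.exists_jNorm_le_kNorm hC hq hp hA hμ hB' hf
  -- A finite J-norm supplies a representation, which places f in the sum. This inclusion comes
  -- first because `h₄` applies only to elements of the K-space.
  have hJK : C.interCouple.jSpace 0 q A ⊆ C.interCouple.kSpace 0 q B := by
    intro f hf
    refine ⟨?_, (h₃ f).trans_lt (ENNReal.mul_lt_top hc₃.lt_top hf)⟩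
    obtain ⟨u, hu⟩ := iInf_lt_iff.1 (show C.interCouple.jNorm 0 q A f < ∞ from hf)
    obtain ⟨hu, -⟩ := iInf_lt_iff.1 hu
    rw [hu.eq_integral]
    exact C.interCouple.exists_sumι_eq _
  constructor
  · refine Coincide.of_le ?_ hc₂ hc₁ (fun f _ => h₂ f) fun f _ => h₁ f
    ext f
    exact ⟨fun hf => (h₁ f).trans_lt (ENNReal.mul_lt_top hc₁.lt_top hf),
      fun hf => (h₂ f).trans_lt (ENNReal.mul_lt_top hc₂.lt_top hf)⟩
  · refine Coincide.of_le (Subset.antisymm hJK fun f hf => ?_) (c₁ := 128) (by simp) hc₃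
      (fun f hf => h₄ f (hJK hf)) fun f _ => h₃ f
    exact (h₄ f hf).trans_lt (ENNReal.mul_lt_top (by simp) hf.2)
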